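/- **Notation.** Let $M\ge 1$, $a=(a_1,\dots,a_M)$ and $b_1,\dots,b_{M-1}$ have positive entries, let $b_0,\bar b_0>0$, and put $b=(b_0,b_1,\dots,b_{M-1})$, $\bar b=(\bar b_0,b_1,\dots,b_{M-1})$. Write $\hat a_i$ for $a$ with $a_i$ removed, and $\Omega=\sum_{i=1}^M n_ia_i$ for $n=(n_1,\dots,n_M)\in\mathbb Z_{\ge0}^M$. For $L\ge0$ and $\alpha\in(0,\infty)^L$ let $f_L(t|\alpha)=t^L\prod_{j=1}^L(1-e^{-\alpha_jt})^{-1}$ (extended by continuity to $t=0$), $B_{L,k}(x|\alpha)=\frac{d^k}{dt^k}\big|_{t=0}\bigl[f_L(t|\alpha)e^{-xt}\bigr]$, and, for $\Re w>0$, $$\log\Gamma_L(w|\alpha)=\int_0^\infty\frac{dt}{t^{L+1}}\Bigl(e^{-wt}f_L(t|\alpha)-\sum_{k=0}^{L-1}\frac{t^k}{k!}B_{L,k}(w|\alpha)-\frac{t^Le^{-t}}{L!}B_{L,L}(w|\alpha)\Bigr).$$ For $\beta=(\beta_0,\dots,\beta_N)$ with positive entries and $\Re q>-\beta_0$ let $$\eta_{L,N}(q|\alpha,\beta)=\exp\Bigl(\sum_{S\subseteq\{1,\dots,N\}}(-1)^{|S|}\bigl[\log\Gamma_L(q+\beta_0+\beta_S|\alpha)-\log\Gamma_L(\beta_0+\beta_S|\alpha)\bigr]\Bigr),\qquad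 \beta_S=\sum_{j\in S}\beta_j .$$ The Barnes beta distribution $\beta_{L,N}(\alpha,\beta)$ is the probability distribution on $(0,\infty)$ whose Mellin transform satisfies $\mathbf E[\beta_{L,N}(\alpha,\beta)^q]=\eta_{L,N}(q|\alpha,\beta)$ for $\Re q>-\beta_0$. If $L=0$, then $\alpha$ is omitted. **Theorem.** The distributions of types $(M,M-1)$, $(M-1,M-1)$ and $(0,M-1)$ used below exist and are unique. Let $\beta_{M,M-1}(a,b,\bar b)=\beta_{M,M-1}(a,b)\,\beta_{M,M-1}^{-1}(a,\bar b)$ with independent factors. Its Mellin transform $\eta_{M,M-1}(q|a,b,\bar b)$ is finite for $-b_0<\Re q<\bar b_0$ and equals $\eta_{M,M-1}(q|a,b)\,\eta_{M,M-1}(-q|a,\bar b)$ there. Moreover, for all such $q$ and all $i=1,\dots,M$, $$\eta_{M,M-1}(q|a,b,\bar b)=\prod_{k=0}^\infty\frac{\eta_{M-1,M-1}(q+ka_i|\hat a_i,b)}{\eta_{M-1,M-1}(ka_i|\hat a_i,b)}\,\frac{\eta_{M-1,M-1}(-q+ka_i|\hat a_i,\bar b)}{\eta_{M-1,M-1}(ka_i|\hat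 a_i,\bar b)},$$ $$\eta_{M,M-1}(q|a,b,\bar b)=\prod_{n_1,\dots,n_M=0}^\infty\ \prod_{S\subseteq\{1,\dots,M-1\}}\Bigl[\frac{b_0+b_S+\Omega}{q+b_0+b_S+\Omega}\,\frac{\bar b_0+b_S+\Omega}{-q+\bar b_0+b_S+\Omega}\Bigr]^{(-1)^{|S|}},\qquad b_S=\sum_{j\in S}b_j,$$ both infinite products (over $k$ and over $n$) converging unconditionally. Probabilistically, $$\beta_{M,M-1}(a,b,\bar b)\overset{\text{law}}{=}\prod_{k=0}^\infty\beta_{M-1,M-1}(\hat a_i,b_0+ka_i,b_1,\dots,b_{M-1})\,\beta_{M-1,M-1}^{-1}(\hat a_i,\bar b_0+ka_i,b_1,\dots,b_{M-1}),$$ $$\beta_{M,M-1}(a,b,\bar b)\overset{\text{law}}{=}\prod_{n_1,\dots,n_M=0}^\infty\beta_{0,M-1}(b_0+\Omega,b_1,\dots,b_{M-1})\,\beta_{0,M-1}^{-1}(\bar b_0+\Omega,b_1,\dots,b_{M-1}),$$ where all variables on each right-hand side are independent and, for every enumeration of the index set ($k\in\mathbb Z_{\ge0}$, respectively $n\in\mathbb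 Z_{\ge0}^M$), the partial products (each index contributing its pair of factors) converge almost surely, to a limit that does not depend on the enumeration up to null sets. Finally, for every $\kappa>0$, $$\beta_{M,M-1}^{\kappa}(\kappa a,\kappa b,\kappa\bar b)\overset{\text{law}}{=}\beta_{M,M-1}(a,b,\bar b).$$ -/

import Mathlib

open MeasureTheory ProbabilityTheory Filter Topology

noncomputable section

/-- `f_M(t | a) = t ^ M * ∏ j, (1 - exp (-a j * t))⁻¹`, extended continuously (hence smoothly, the
singularity being removable) to `t = 0`, where its value is `∏ j, (a j)⁻¹`. -/
def barnesF {M : ℕ} (a : Fin M → ℝ) (t : ℝ) : ℝ :=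
  if t = 0 then ∏ j, (a j)⁻¹ else t ^ M * ∏ j, (1 - Real.exp (-a j * t))⁻¹

/-- The multiple Bernoulli polynomial `B_{M,m}(x | a)`, the `m`-th derivative at `t = 0` of
`f_M(t | a) * exp (-x * t)`. -/
def multipleBernoulli {M : ℕ} (a : Fin M → ℝ) (m : ℕ) (x : ℂ) : ℂ :=
  iteratedDeriv m (fun t : ℝ => (barnesF a t : ℂ) * Complex.exp (-x * t)) 0

/-- The logarithm of the Barnes multiple gamma function `Γ_M(w | a)` in the normalization of
Ruijsenaars, given for `0 < re w` and positive `a` by its Malmstén-type integral. -/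
def logMultipleGamma {M : ℕ} (a : Fin M → ℝ) (w : ℂ) : ℂ :=
  ∫ t in Set.Ioi (0 : ℝ), ((t : ℂ) ^ (M + 1))⁻¹ *
    (Complex.exp (-w * t) * (barnesF a t : ℂ)
      - ∑ k ∈ Finset.range M, (t : ℂ) ^ k / (k.factorial : ℂ) * multipleBernoulli a k w
      - (t : ℂ) ^ M * Complex.exp (-(t : ℂ)) / (M.factorial : ℂ) * multipleBernoulli a M w)

/-- The operator `𝒮_N`: the alternating sum of `h (q + b₀ + ∑ j ∈ s, b j)` over all subsets `s`
of the `N` indices. -/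
def barnesS {N : ℕ} (h : ℂ → ℂ) (q : ℂ) (b₀ : ℝ) (b : Fin N → ℝ) : ℂ :=
  ∑ s : Finset (Fin N), (-1 : ℂ) ^ s.card * h (q + b₀ + ∑ j ∈ s, (b j : ℂ))

/-- `η_{M,N}(q | a, b)` with `b = (b₀, b 0, …, b (N - 1))`, for `-b₀ < re q`. -/
def barnesEta {M N : ℕ} (a : Fin M → ℝ) (b₀ : ℝ) (b : Fin N → ℝ) (q : ℂ) : ℂ :=
  Complex.exp (barnesS (logMultipleGamma a) q b₀ b - barnesS (logMultipleGamma a) 0 b₀ b)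

/-- `μ` is a probability distribution on `(0, ∞)` whose Mellin transform is finite and equal to
`η_{M,N}(q | a, b)` for all complex `q` with `-b₀ < re q`. -/
structure IsBarnesBeta {M N : ℕ} (a : Fin M → ℝ) (b₀ : ℝ) (b : Fin N → ℝ) (μ : Measure ℝ) :
    Prop where
  isProbabilityMeasure : IsProbabilityMeasure μ
  pos : ∀ᵐ x ∂μ, 0 < x
  integrable : ∀ q : ℂ, -b₀ < q.re → Integrable (fun x : ℝ => (x : ℂ) ^ q) μ
  mellin : ∀ q : ℂ, -b₀ < q.re → ∫ x : ℝ, (x : ℂ) ^ q ∂μ = barnesEta a b₀ b q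

open Classical in
/-- The Barnes beta distribution `β_{M,N}(a, b)` of type `(M, N)`: the law on `(0, ∞)` with Mellin
transform `η_{M,N}(q | a, b)` (and, by convention, the zero measure where there is none). -/
def barnesBeta {M N : ℕ} (a : Fin M → ℝ) (b₀ : ℝ) (b : Fin N → ℝ) : Measure ℝ :=
  if h : ∃ μ : Measure ℝ, IsBarnesBeta a b₀ b μ then h.choose else 0

/-- The law of `β_{M,N}(a, b) * β_{M,N}(a, b')⁻¹`, the two factors being independent, where
`b = (b₀, b 0, …)` and `b' = (c₀, b 0, …)`. -/
def barnesRatio {M N : ℕ} (a : Fin M → ℝ) (b₀ c₀ : ℝ) (b : Fin N → ℝ) : Measure ℝ :=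
  ((barnesBeta a b₀ b).prod (barnesBeta a c₀ b)).map (fun p => p.1 * p.2⁻¹)

/-- `Ω = ∑ i, n i * a i`. -/
def latticePoint {M : ℕ} (a : Fin M → ℝ) (n : Fin M → ℕ) : ℝ := ∑ i, (n i : ℝ) * a i

/-- The random variable `Z` is the infinite product of the random variables `X i` over the
(countably infinite) index set `ι`: for every enumeration of `ι`, the partial products converge
to `Z` almost surely. -/
def IsInfiniteProduct {Ω ι : Type*} [MeasurableSpace Ω] (P : Measure Ω) (X : ι → Ω → ℝ)
    (Z : Ω → ℝ) : Prop :=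
  ∀ e : ℕ ≃ ι, ∀ᵐ ω ∂P,
    Tendsto (fun n : ℕ => ∏ k ∈ Finset.range n, X (e k) ω) atTop (𝓝 (Z ω))

end

/-! Everything reduces to one integral. Inserting the Malmstén integral into the alternating sum
over subsets turns the shifts by `b j` into the product of the `1 - exp (-b j * t)`, and the sum
vanishes at the origin to order `N + 1`. For `M ≤ N + 1` all Bernoulli terms of degree below `M`
therefore drop out, and `log η` is the integral of `(exp (-q t) - 1) ρ(t) + q c exp (-t) / t`, where
`ρ(t) = exp (-b₀ t) K(t) / t` is positive, `K` is `barnesKernel` and `c` is nonzero only for `M = N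
+ 1` (`integrableOn_barnesExponent_and_barnesEta_eq`). This is a Lévy–Khintchine exponent, so
`exists_levyKhintchine` supplies the law of the logarithm. That law is built as a sum of independent
centered compound Poisson variables, one for each slice of the Lévy measure. Uniqueness is
injectivity of the characteristic function after taking logarithms.

In the ratio the two compensators `± q c exp (-t) / t` cancel, because `c` does not depend on `b₀`.
What remains is linear in the kernel `K` alone. Both factorizations are then geometric series:
expanding one factor `(1 - exp (-a i * t))⁻¹`, or all of them, writes `K` as a sum of terms `exp (-o
n * t) K'(t)`, and multiplying by `exp (-o n * t)` only moves `b₀` and `c₀` to `b₀ + o n` and `c₀ +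
o n`. The terms are positive, so integrating gives an unconditionally convergent sum of exponents
(`hasSum_integral_ratioExponent`), hence the infinite products. For type `(0, N)` the factors are
explicit by Frullani's integral.

The probabilistic statements follow from `IsSummableFamily.exists_tendsto`: for independent
variables whose log-moments are summable on a strip about the imaginary axis, partial sums converge
almost surely by martingale convergence, the limit is the same for all enumerations because the
characteristic function of the difference of partial sums tends to `1`, and moments pass to the
limit by uniform integrability. Scaling invariance is the substitution `t ↦ κ t`. -/

noncomputable section

/-! ### Removable singularities at the origin -/

/-- The function `(1 - exp (-a * t)) / t`, extended continuously to `t = 0`. -/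
def expSlope (a : ℝ) : ℝ → ℝ := dslope (fun t : ℝ => 1 - Real.exp (-a * t)) 0

/-- The function `(exp (-q * t) - 1) / t`, extended continuously to `t = 0`. -/
def cexpSlope (q : ℂ) : ℝ → ℂ := dslope (fun t : ℝ => Complex.exp (-q * t) - 1) 0

theorem AnalyticAt.dslope_self {E : Type*} [NormedAddCommGroup E] [NormedSpace ℝ E]
    {f : ℝ → E} {x : ℝ} (hf : AnalyticAt ℝ f x) : AnalyticAt ℝ (dslope f x) x := by
  obtain ⟨p, hp⟩ := hf
  exact ⟨_, hp.has_fpower_series_dslope_fslope⟩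

theorem analyticAt_cexp_mul (q : ℂ) (x : ℝ) :
    AnalyticAt ℝ (fun t : ℝ => Complex.exp (q * t)) x := by
  have h1 : AnalyticAt ℝ Complex.exp (q * x) := (Complex.differentiable_exp.analyticAt _).restrictScalars
  have h2 : AnalyticAt ℝ (fun t : ℝ => q * (t : ℂ)) x :=
    analyticAt_const.mul (Complex.ofRealCLM.analyticAt x)
  exact AnalyticAt.fun_comp (f := fun t : ℝ => q * (t : ℂ)) h1 h2

theorem analyticAt_expSlope (a : ℝ) : AnalyticAt ℝ (expSlope a) 0 := by
  apply AnalyticAt.dslope_self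
  fun_prop

theorem analyticAt_cexpSlope (q : ℂ) : AnalyticAt ℝ (cexpSlope q) 0 :=
  AnalyticAt.dslope_self ((analyticAt_cexp_mul (-q) 0).sub analyticAt_const)

theorem expSlope_zero (a : ℝ) : expSlope a 0 = a := by
  have h : HasDerivAt (fun t : ℝ => 1 - Real.exp (-a * t)) (-(Real.exp (-a * 0) * (-a * 1))) 0 :=
    (((hasDerivAt_id (0 : ℝ)).const_mul (-a)).exp).const_sub 1
  rw [expSlope, dslope_same, h.deriv]
  simp

theorem cexpSlope_zero (q : ℂ) : cexpSlope q 0 = -q := by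
  have h : HasDerivAt (fun t : ℝ => Complex.exp (-q * t) - 1)
      (Complex.exp (-q * (0 : ℝ)) * (-q * 1)) 0 :=
    (((hasDerivAt_id (0 : ℝ)).ofReal_comp.const_mul (-q)).cexp).sub_const 1
  rw [cexpSlope, dslope_same, h.deriv]
  simp

theorem mul_expSlope (a t : ℝ) : t * expSlope a t = 1 - Real.exp (-a * t) := by
  have := sub_smul_dslope (fun t : ℝ => 1 - Real.exp (-a * t)) 0 t
  simpa [expSlope] using this

theorem mul_cexpSlope (q : ℂ) (t : ℝ) : (t : ℂ) * cexpSlope q t = Complex.exp (-q * t) - 1 := by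
  have := sub_smul_dslope (fun t : ℝ => Complex.exp (-q * t) - 1) 0 t
  simpa [cexpSlope] using this

/-- Giving one power of `t` to each factor removes the singularity: the divided slopes are analytic
at `0` with nonzero value `a j`, whence analyticity of `barnesF`. -/
theorem barnesF_eq_prod {M : ℕ} (a : Fin M → ℝ) (t : ℝ) :
    barnesF a t = ∏ j, (expSlope (a j) t)⁻¹ := by
  unfold barnesF
  split_ifs with h
  · simp [h, expSlope_zero]
  · simp_rw [← mul_expSlope, mul_inv]
    rw [Finset.prod_mul_distrib]
    simp [h]

theorem analyticAt_barnesF {M : ℕ} {a : Fin M → ℝ} (ha : ∀ i, 0 < a i) :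
    AnalyticAt ℝ (barnesF a) 0 := by
  have : barnesF a = fun t => ∏ j, (expSlope (a j) t)⁻¹ := funext (barnesF_eq_prod a)
  rw [this]
  refine Finset.analyticAt_fun_prod _ fun j _ => (analyticAt_expSlope _).fun_inv ?_
  simpa [expSlope_zero] using (ha j).ne'

theorem analyticAt_ofReal_comp {f : ℝ → ℝ} {x : ℝ} (hf : AnalyticAt ℝ f x) :
    AnalyticAt ℝ (fun t => (f t : ℂ)) x :=
  AnalyticAt.fun_comp (g := fun s : ℝ => (s : ℂ)) (Complex.ofRealCLM.analyticAt _) hf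

theorem one_sub_exp_pos {a t : ℝ} (ha : 0 < a) (ht : 0 < t) : 0 < 1 - Real.exp (-a * t) := by
  have := Real.exp_lt_exp.2 (show -a * t < 0 by nlinarith [mul_pos ha ht])
  rw [Real.exp_zero] at this
  linarith

theorem barnesF_of_pos {M : ℕ} (a : Fin M → ℝ) {t : ℝ} (ht : 0 < t) :
    barnesF a t = t ^ M * ∏ j, (1 - Real.exp (-a j * t))⁻¹ := if_neg ht.ne'

theorem continuousOn_barnesF {M : ℕ} {a : Fin M → ℝ} (ha : ∀ i, 0 < a i) :
    ContinuousOn (barnesF a) (Set.Ioi 0) := by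
  have h : ContinuousOn (fun t : ℝ => t ^ M * ∏ j, (1 - Real.exp (-a j * t))⁻¹) (Set.Ioi 0) := by
    refine ContinuousOn.mul (by fun_prop) (continuousOn_finsetProd _ fun j _ => ?_)
    exact ContinuousOn.inv₀ (by fun_prop) fun t ht => (one_sub_exp_pos (ha j) ht).ne'
  exact h.congr fun t ht => barnesF_of_pos a ht

/-! ### Regularized integrals of Malmstén type -/

/-- The regularized integrand `t ^ (-L - 1) * (G t - ∑ k < L, …)` of Malmstén type attached to a
function `G` which is smooth at the origin. -/
def malmstenIntegrand (L : ℕ) (G : ℝ → ℂ) (t : ℝ) : ℂ :=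
  ((t : ℂ) ^ (L + 1))⁻¹ * (G t
      - ∑ k ∈ Finset.range L, (t : ℂ) ^ k / (k.factorial : ℂ) * iteratedDeriv k G 0
      - (t : ℂ) ^ L * Complex.exp (-(t : ℂ)) / (L.factorial : ℂ) * iteratedDeriv L G 0)

/-- The Taylor terms of degree below `L` cancel exactly. In degree `L` the factor `exp (-t)` leaves
a multiple of `(1 - exp (-t)) / t`, so near `0` the integrand agrees with a function continuous at
`0` and is bounded. -/
theorem exists_integrableOn_malmstenIntegrand_Ioc {L : ℕ} {G : ℝ → ℂ} (hG : AnalyticAt ℝ G 0)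
    (hGc : ContinuousOn G (Set.Ioi 0)) :
    ∃ ε > 0, IntegrableOn (malmstenIntegrand L G) (Set.Ioc 0 ε) := by
  obtain ⟨F, hF, hGF⟩ := hG.exists_eventuallyEq_sum_add_pow_mul (L + 1)
  set Q : ℝ → ℂ := fun t => iteratedDeriv L G 0 / (L.factorial : ℂ) * (expSlope 1 t : ℂ) + F t
  have hQ : ContinuousAt Q 0 := by
    refine ContinuousAt.add (continuousAt_const.mul ?_) hF.continuousAt
    exact Complex.continuous_ofReal.continuousAt.comp (analyticAt_expSlope 1).continuousAt
  have hb : ∀ᶠ t in 𝓝 (0 : ℝ), ‖Q t‖ < ‖Q 0‖ + 1 :=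
    hQ.norm.eventually_lt_const (lt_add_one _)
  obtain ⟨ε, hε, hball⟩ := Metric.eventually_nhds_iff.1 (hGF.and hb)
  refine ⟨ε / 2, half_pos hε, ?_⟩
  have hcont : ContinuousOn (malmstenIntegrand L G) (Set.Ioi 0) := by
    unfold malmstenIntegrand
    refine ContinuousOn.mul (ContinuousOn.inv₀ (by fun_prop) fun t ht => ?_)
      ((hGc.sub (by fun_prop)).sub (by fun_prop))
    exact pow_ne_zero _ (Complex.ofReal_ne_zero.2 (ne_of_gt ht))
  have hM : AEStronglyMeasurable (malmstenIntegrand L G) (volume.restrict (Set.Ioc 0 (ε / 2))) :=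
    (hcont.mono fun t ht => ht.1).aestronglyMeasurable measurableSet_Ioc
  refine Integrable.of_bound hM (‖Q 0‖ + 1) ?_
  refine (ae_restrict_iff' measurableSet_Ioc).2 (ae_of_all _ fun t ht => ?_)
  have hd : dist t 0 < ε := by
    rw [Real.dist_eq, sub_zero, abs_of_pos ht.1]; linarith [ht.2]
  obtain ⟨h1, h2⟩ := hball hd
  have ht0 : (t : ℂ) ≠ 0 := Complex.ofReal_ne_zero.2 ht.1.ne'
  have : malmstenIntegrand L G t = Q t := by
    have he : (t : ℂ) * (expSlope 1 t : ℂ) = 1 - Complex.exp (-t) := by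
      have := mul_expSlope 1 t
      rw [← Complex.ofReal_mul, this]; push_cast; simp
    unfold malmstenIntegrand
    rw [h1, Finset.sum_range_succ]
    simp only [Complex.real_smul, Q]
    push_cast
    have he' : Complex.exp (-t) = 1 - (t : ℂ) * (expSlope 1 t : ℂ) := by rw [he]; ring
    rw [he']
    have hfac : (L.factorial : ℂ) ≠ 0 := by exact_mod_cast L.factorial_ne_zero
    field_simp
    ring
  rw [this]; exact h2.le

/-- Away from `0` the pieces are integrable one by one: `t ^ (k - L - 1)` has exponent below `-1`
for `k < L`, and the last term, of size `1 / t`, is saved by its factor `exp (-t)`. -/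
theorem integrableOn_malmstenIntegrand {L : ℕ} {G : ℝ → ℂ} (hG : AnalyticAt ℝ G 0)
    (hGc : ContinuousOn G (Set.Ioi 0))
    (hGi : ∀ ε > 0, IntegrableOn (fun t : ℝ => ((t : ℂ) ^ (L + 1))⁻¹ * G t) (Set.Ioi ε)) :
    IntegrableOn (malmstenIntegrand L G) (Set.Ioi 0) := by
  obtain ⟨ε, hε, h1⟩ := exists_integrableOn_malmstenIntegrand_Ioc (L := L) hG hGc
  rw [← Set.Ioc_union_Ioi_eq_Ioi hε.le]
  refine h1.union ?_
  have h2 : ∀ k ∈ Finset.range L, IntegrableOn (fun t : ℝ => ((t : ℂ) ^ (L + 1))⁻¹ *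
      ((t : ℂ) ^ k / (k.factorial : ℂ) * iteratedDeriv k G 0)) (Set.Ioi ε) := by
    intro k hk
    have hk' : (k : ℝ) - ((L + 1 : ℕ) : ℝ) < -1 := by
      have : (k : ℝ) < L := by exact_mod_cast Finset.mem_range.1 hk
      push_cast; linarith
    have := ((integrableOn_Ioi_rpow_of_lt hk' hε).ofReal (𝕜 := ℂ)).mul_const
      ((k.factorial : ℂ)⁻¹ * iteratedDeriv k G 0)
    refine IntegrableOn.congr_fun this (fun t ht => ?_) measurableSet_Ioi
    have ht0 : (0 : ℝ) < t := hε.trans ht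
    simp only [RCLike.ofReal_eq_complex_ofReal]
    rw [Real.rpow_sub ht0, Real.rpow_natCast, Real.rpow_natCast]
    push_cast
    ring
  have h3 : IntegrableOn (fun t : ℝ => ((t : ℂ) ^ (L + 1))⁻¹ *
      ((t : ℂ) ^ L * Complex.exp (-(t : ℂ)) / (L.factorial : ℂ) * iteratedDeriv L G 0))
      (Set.Ioi ε) := by
    have hi : IntegrableOn (fun t : ℝ => t⁻¹ * Real.exp (-1 * t)) (Set.Ioi ε) := by
      refine Integrable.mono' ((exp_neg_integrableOn_Ioi ε one_pos).const_mul ε⁻¹) ?_ ?_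
      · exact (Measurable.aestronglyMeasurable (by fun_prop))
      · refine (ae_restrict_iff' measurableSet_Ioi).2 (ae_of_all _ fun t ht => ?_)
        have ht0 : (0 : ℝ) < t := hε.trans ht
        rw [Real.norm_of_nonneg (by positivity)]
        have : t⁻¹ ≤ ε⁻¹ := inv_anti₀ hε (le_of_lt ht)
        gcongr
    refine IntegrableOn.congr_fun (Integrable.mul_const (Integrable.ofReal (𝕜 := ℂ) hi)
      ((L.factorial : ℂ)⁻¹ * iteratedDeriv L G 0)) (fun t ht => ?_) measurableSet_Ioi
    have ht0 : (t : ℂ) ≠ 0 := Complex.ofReal_ne_zero.2 (hε.trans ht).ne'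
    simp only [RCLike.ofReal_eq_complex_ofReal]
    push_cast
    rw [pow_succ, neg_one_mul]
    field_simp
  have h4 := ((hGi ε hε).sub (integrable_finsetSum _ h2)).sub h3
  refine h4.congr (ae_of_all _ fun t => ?_)
  simp only [malmstenIntegrand, Pi.sub_apply]
  rw [← Finset.mul_sum]
  ring

theorem malmstenIntegrand_sum {ι : Type*} (s : Finset ι) (L : ℕ) (c : ι → ℂ) (G : ι → ℝ → ℂ)
    (hG : ∀ i, AnalyticAt ℝ (G i) 0) (t : ℝ) :
    malmstenIntegrand L (fun t => ∑ i ∈ s, c i * G i t) t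
      = ∑ i ∈ s, c i * malmstenIntegrand L (G i) t := by
  have hD : ∀ k, iteratedDeriv k (fun t => ∑ i ∈ s, c i * G i t) 0
      = ∑ i ∈ s, c i * iteratedDeriv k (G i) 0 := by
    intro k
    rw [iteratedDeriv_fun_sum]
    · exact Finset.sum_congr rfl fun i _ => iteratedDeriv_const_mul_field _ _
    · intro i _
      exact (analyticAt_const.mul (hG i)).contDiffAt
  unfold malmstenIntegrand
  simp only [hD, mul_sub, Finset.mul_sum, Finset.sum_sub_distrib]
  congr 1
  · congr 1
    · exact Finset.sum_congr rfl fun i _ => by ring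
    · rw [Finset.sum_comm]
      exact Finset.sum_congr rfl fun i _ => Finset.sum_congr rfl fun k _ => by ring
  · exact Finset.sum_congr rfl fun i _ => by ring

/-- The derivatives at the origin of a function vanishing there to order `n`. -/
theorem iteratedDeriv_pow_mul_zero {n : ℕ} {h : ℝ → ℂ} (hh : AnalyticAt ℝ h 0) :
    (∀ k < n, iteratedDeriv k (fun t : ℝ => (t : ℂ) ^ n * h t) 0 = 0) ∧
      iteratedDeriv n (fun t : ℝ => (t : ℂ) ^ n * h t) 0 = n.factorial * h 0 := by
  have hH : AnalyticAt ℝ (fun t : ℝ => (t : ℂ) ^ n * h t) 0 :=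
    ((Complex.ofRealCLM.analyticAt (0 : ℝ)).pow n).mul hh
  have h0 : ∀ k < n, iteratedDeriv k (fun t : ℝ => (t : ℂ) ^ n * h t) 0 = 0 := by
    refine (natCast_le_analyticOrderAt_iff_iteratedDeriv_eq_zero hH).1 ?_
    refine (natCast_le_analyticOrderAt hH).2 ⟨h, hh, Eventually.of_forall fun t => ?_⟩
    simp
  refine ⟨h0, ?_⟩
  obtain ⟨F, hF, hGF⟩ := hH.exists_eventuallyEq_sum_add_pow_mul (n + 1)
  set D := iteratedDeriv n (fun t : ℝ => (t : ℂ) ^ n * h t) 0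
  have hn : (n.factorial : ℂ) ≠ 0 := by exact_mod_cast n.factorial_ne_zero
  -- Cancel `t ^ n` off the origin in the Taylor expansion; letting `t → 0` identifies `h 0`.
  have h1 : ∀ᶠ t : ℝ in 𝓝[≠] 0, h t = D / n.factorial + t * F t := by
    filter_upwards [hGF.filter_mono nhdsWithin_le_nhds, self_mem_nhdsWithin] with t ht ht0
    have ht0 : (t : ℂ) ≠ 0 := Complex.ofReal_ne_zero.2 ht0
    rw [Finset.sum_range_succ, Finset.sum_eq_zero (fun k hk => by
      rw [h0 k (Finset.mem_range.1 hk), smul_zero])] at ht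
    simp only [Complex.real_smul] at ht
    push_cast at ht
    have h2 : (t : ℂ) ^ n * h t = t ^ n * (D / n.factorial + t * F t) := by
      rw [ht]; ring
    exact mul_left_cancel₀ (pow_ne_zero _ ht0) h2
  have l1 : Tendsto h (𝓝[≠] 0) (𝓝 (h 0)) := hh.continuousAt.tendsto.mono_left nhdsWithin_le_nhds
  have l2 : Tendsto (fun t : ℝ => D / n.factorial + (t : ℂ) * F t) (𝓝[≠] 0)
      (𝓝 (D / n.factorial + ((0 : ℝ) : ℂ) * F 0)) := by
    refine Tendsto.mono_left ?_ nhdsWithin_le_nhds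
    exact tendsto_const_nhds.add
      ((Complex.continuous_ofReal.tendsto 0).mul hF.continuousAt.tendsto)
  have h2 := tendsto_nhds_unique (l1.congr' h1) l2
  rw [h2]
  simp
  field_simp

/-- For a function vanishing to order `n ≥ L` at the origin, the regularization is trivial if
`n > L` and reduces to its last term if `n = L`. -/
theorem malmstenIntegrand_pow_mul {L n : ℕ} (hL : L ≤ n) {h : ℝ → ℂ} (hh : AnalyticAt ℝ h 0)
    {t : ℝ} (ht : 0 < t) :
    malmstenIntegrand L (fun t : ℝ => (t : ℂ) ^ n * h t) t
      = ((t : ℂ) ^ (L + 1))⁻¹ * ((t : ℂ) ^ n * h t)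
        - (if L = n then h 0 else 0) * (Complex.exp (-t) / t) := by
  obtain ⟨h0, hn⟩ := iteratedDeriv_pow_mul_zero (n := n) hh
  have ht0 : (t : ℂ) ≠ 0 := Complex.ofReal_ne_zero.2 ht.ne'
  unfold malmstenIntegrand
  rw [Finset.sum_eq_zero fun k hk => by
    rw [h0 k ((Finset.mem_range.1 hk).trans_le hL), mul_zero]]
  split_ifs with hLn
  · subst hLn
    rw [hn]
    have hfac : (L.factorial : ℂ) ≠ 0 := by exact_mod_cast L.factorial_ne_zero
    field_simp
    ring
  · rw [h0 L (lt_of_le_of_ne hL hLn)]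
    ring

/-! ### The Lévy density and the integral for `log η` -/

/-- The kernel `∏ j, (1 - exp (-b j * t)) / ∏ i, (1 - exp (-a i * t))`. -/
def barnesKernel {M N : ℕ} (a : Fin M → ℝ) (b : Fin N → ℝ) (t : ℝ) : ℝ :=
  (∏ j, (1 - Real.exp (-b j * t))) * ∏ i, (1 - Real.exp (-a i * t))⁻¹

/-- The Lévy density of `-log β_{M,N}(a, b)`. -/
def levyDensity {M N : ℕ} (a : Fin M → ℝ) (b₀ : ℝ) (b : Fin N → ℝ) (t : ℝ) : ℝ :=
  Real.exp (-b₀ * t) * barnesKernel a b t / t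

/-- The coefficient of `1 / t ^ 2` in the Lévy density at the origin when `M = N + 1`. -/
def levyCoeff {M N : ℕ} (a : Fin M → ℝ) (b : Fin N → ℝ) : ℝ :=
  if M = N + 1 then (∏ i, (a i)⁻¹) * ∏ j, b j else 0

/-- The integrand of `log η_{M,N}(q | a, b)`. -/
def barnesExponent {M N : ℕ} (a : Fin M → ℝ) (b₀ : ℝ) (b : Fin N → ℝ) (q : ℂ) (t : ℝ) : ℂ :=
  (Complex.exp (-q * t) - 1) * levyDensity a b₀ b t
    + q * levyCoeff a b * (Complex.exp (-t) / t)

theorem barnesKernel_pos {M N : ℕ} {a : Fin M → ℝ} {b : Fin N → ℝ} (ha : ∀ i, 0 < a i)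
    (hb : ∀ j, 0 < b j) {t : ℝ} (ht : 0 < t) : 0 < barnesKernel a b t :=
  mul_pos (Finset.prod_pos fun j _ => one_sub_exp_pos (hb j) ht)
    (Finset.prod_pos fun i _ => inv_pos.2 (one_sub_exp_pos (ha i) ht))

theorem levyDensity_pos {M N : ℕ} {a : Fin M → ℝ} {b : Fin N → ℝ} (ha : ∀ i, 0 < a i)
    (hb : ∀ j, 0 < b j) (b₀ : ℝ) {t : ℝ} (ht : 0 < t) : 0 < levyDensity a b₀ b t :=
  div_pos (mul_pos (Real.exp_pos _) (barnesKernel_pos ha hb ht)) ht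

@[fun_prop]
theorem measurable_barnesKernel {M N : ℕ} (a : Fin M → ℝ) (b : Fin N → ℝ) :
    Measurable (barnesKernel a b) := by
  unfold barnesKernel; fun_prop

@[fun_prop]
theorem measurable_levyDensity {M N : ℕ} (a : Fin M → ℝ) (b₀ : ℝ) (b : Fin N → ℝ) :
    Measurable (levyDensity a b₀ b) := by
  unfold levyDensity; fun_prop

/-- The function whose regularized integral is `log Γ_M(w | a)`. -/
def barnesG {M : ℕ} (a : Fin M → ℝ) (w : ℂ) (t : ℝ) : ℂ :=
  (barnesF a t : ℂ) * Complex.exp (-w * t)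

theorem analyticAt_barnesG {M : ℕ} {a : Fin M → ℝ} (ha : ∀ i, 0 < a i) (w : ℂ) :
    AnalyticAt ℝ (barnesG a w) 0 :=
  (analyticAt_ofReal_comp (analyticAt_barnesF ha)).mul (analyticAt_cexp_mul (-w) 0)

theorem logMultipleGamma_eq {M : ℕ} (a : Fin M → ℝ) (w : ℂ) :
    logMultipleGamma a w = ∫ t in Set.Ioi (0 : ℝ), malmstenIntegrand M (barnesG a w) t := by
  unfold logMultipleGamma malmstenIntegrand barnesG multipleBernoulli
  simp only [mul_comm]

theorem norm_cexp_neg_mul (w : ℂ) (t : ℝ) :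
    ‖Complex.exp (-w * t)‖ = Real.exp (-w.re * t) := by
  rw [Complex.norm_exp]; simp

/-- On `(ε, ∞)` each factor `(1 - exp (-a j * t))⁻¹` is at most its value at `ε`, so the decay of
`exp (-w t)` gives integrability there. -/
theorem integrableOn_malmstenIntegrand_barnesG {M : ℕ} {a : Fin M → ℝ} (ha : ∀ i, 0 < a i)
    {w : ℂ} (hw : 0 < w.re) :
    IntegrableOn (malmstenIntegrand M (barnesG a w)) (Set.Ioi 0) := by
  have hc : ContinuousOn (barnesG a w) (Set.Ioi 0) :=
    (Complex.continuous_ofReal.comp_continuousOn (continuousOn_barnesF ha)).mul (by fun_prop)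
  refine integrableOn_malmstenIntegrand (analyticAt_barnesG ha w) hc fun ε hε => ?_
  have hm : AEStronglyMeasurable (fun t : ℝ => ((t : ℂ) ^ (M + 1))⁻¹ * barnesG a w t)
      (volume.restrict (Set.Ioi ε)) := by
    refine ContinuousOn.aestronglyMeasurable ?_ measurableSet_Ioi
    refine ContinuousOn.mul (ContinuousOn.inv₀ (by fun_prop) fun t ht => ?_)
      (hc.mono fun t ht => hε.trans ht)
    exact pow_ne_zero _ (Complex.ofReal_ne_zero.2 (hε.trans ht).ne')
  refine Integrable.mono' ((exp_neg_integrableOn_Ioi ε hw).const_mul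
    (ε⁻¹ * ∏ j, (1 - Real.exp (-a j * ε))⁻¹)) hm ?_
  refine (ae_restrict_iff' measurableSet_Ioi).2 (ae_of_all _ fun t ht => ?_)
  have ht' : ε < t := ht
  have ht0 : 0 < t := hε.trans ht'
  have hP : 0 ≤ ∏ j, (1 - Real.exp (-a j * t))⁻¹ :=
    Finset.prod_nonneg fun j _ => (inv_pos.2 (one_sub_exp_pos (ha j) ht0)).le
  rw [barnesG, barnesF_of_pos a ht0, norm_mul, norm_mul, norm_cexp_neg_mul, Complex.norm_real,
    norm_inv, norm_pow, Complex.norm_real, Real.norm_of_nonneg ht0.le,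
    Real.norm_of_nonneg (mul_nonneg (by positivity) hP)]
  have e : (t ^ (M + 1))⁻¹ * (t ^ M * (∏ j, (1 - Real.exp (-a j * t))⁻¹) * Real.exp (-w.re * t))
      = t⁻¹ * (∏ j, (1 - Real.exp (-a j * t))⁻¹) * Real.exp (-w.re * t) := by
    rw [pow_succ]; field_simp
  rw [e]
  have h1 : t⁻¹ ≤ ε⁻¹ := inv_anti₀ hε ht'.le
  have h2 : ∏ j, (1 - Real.exp (-a j * t))⁻¹ ≤ ∏ j, (1 - Real.exp (-a j * ε))⁻¹ := by
    refine Finset.prod_le_prod (fun j _ => (inv_pos.2 (one_sub_exp_pos (ha j) ht0)).le)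
      fun j _ => inv_anti₀ (one_sub_exp_pos (ha j) hε) ?_
    have : Real.exp (-a j * t) ≤ Real.exp (-a j * ε) :=
      Real.exp_le_exp.2 (by nlinarith [ha j])
    linarith
  gcongr

theorem sum_finset_exp_neg {N : ℕ} (b : Fin N → ℝ) (t : ℝ) :
    ∑ s : Finset (Fin N), (-1 : ℂ) ^ s.card * Complex.exp (-(∑ j ∈ s, (b j : ℂ)) * t)
      = ∏ j, (1 - Complex.exp (-(b j : ℂ) * t)) := by
  have h := Finset.prod_one_add (f := fun j => -Complex.exp (-(b j : ℂ) * t))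
    (Finset.univ : Finset (Fin N))
  simp only [← sub_eq_add_neg] at h
  rw [h, Finset.powerset_univ]
  refine Finset.sum_congr rfl fun s _ => ?_
  rw [Finset.prod_neg, ← Complex.exp_sum, ← Finset.sum_mul, Finset.sum_neg_distrib]

/-- The alternating sum of the functions `barnesG` over all shifts, which vanishes to order
`N + 1` at the origin. -/
theorem sum_barnesG_sub {M N : ℕ} (a : Fin M → ℝ) (b₀ : ℝ) (b : Fin N → ℝ) (q : ℂ) (t : ℝ) :
    ∑ s : Finset (Fin N), (-1 : ℂ) ^ s.card *
        (barnesG a (q + b₀ + ∑ j ∈ s, (b j : ℂ)) t - barnesG a (0 + b₀ + ∑ j ∈ s, (b j : ℂ)) t)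
      = (Complex.exp (-q * t) - 1) *
        ((barnesF a t * Real.exp (-b₀ * t) * ∏ j, (1 - Real.exp (-b j * t)) : ℝ) : ℂ) := by
  have key : ∀ s : Finset (Fin N), (-1 : ℂ) ^ s.card *
        (barnesG a (q + b₀ + ∑ j ∈ s, (b j : ℂ)) t - barnesG a (0 + b₀ + ∑ j ∈ s, (b j : ℂ)) t)
      = (Complex.exp (-q * t) - 1) * barnesF a t * Complex.exp (-b₀ * t) *
        ((-1 : ℂ) ^ s.card * Complex.exp (-(∑ j ∈ s, (b j : ℂ)) * t)) := by
    intro s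
    unfold barnesG
    have e1 : Complex.exp (-(q + b₀ + ∑ j ∈ s, (b j : ℂ)) * t)
        = Complex.exp (-q * t) * Complex.exp (-b₀ * t)
          * Complex.exp (-(∑ j ∈ s, (b j : ℂ)) * t) := by
      rw [← Complex.exp_add, ← Complex.exp_add]; ring_nf
    have e2 : Complex.exp (-(0 + b₀ + ∑ j ∈ s, (b j : ℂ)) * t)
        = Complex.exp (-b₀ * t) * Complex.exp (-(∑ j ∈ s, (b j : ℂ)) * t) := by
      rw [← Complex.exp_add]; ring_nf
    rw [e1, e2]; ring
  simp_rw [key]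
  rw [← Finset.mul_sum, sum_finset_exp_neg]
  push_cast
  ring

/-- The logarithm of `η_{M,N}` as an integral of Lévy–Khintchine type. -/
theorem integrableOn_barnesExponent_and_barnesEta_eq {M N : ℕ} {a : Fin M → ℝ}
    {b : Fin N → ℝ} (hMN : M ≤ N + 1) (ha : ∀ i, 0 < a i) (hb : ∀ j, 0 < b j) {b₀ : ℝ}
    (hb₀ : 0 < b₀) {q : ℂ} (hq : -b₀ < q.re) :
    IntegrableOn (barnesExponent a b₀ b q) (Set.Ioi 0) ∧
      barnesEta a b₀ b q = Complex.exp (∫ t in Set.Ioi (0 : ℝ), barnesExponent a b₀ b q t) := by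
  have hpos : ∀ p : ℂ, -b₀ < p.re → ∀ s : Finset (Fin N),
      0 < (p + b₀ + ∑ j ∈ s, (b j : ℂ)).re := by
    intro p hp s
    have : 0 ≤ ∑ j ∈ s, b j := Finset.sum_nonneg fun j _ => (hb j).le
    simp only [Complex.add_re, Complex.ofReal_re, Complex.re_sum]
    linarith
  have h0 : -b₀ < (0 : ℂ).re := by simpa using hb₀
  have hint : ∀ s ∈ (Finset.univ : Finset (Finset (Fin N))), IntegrableOn (fun t =>
      (-1 : ℂ) ^ s.card * (malmstenIntegrand M (barnesG a (q + b₀ + ∑ j ∈ s, (b j : ℂ))) t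
        - malmstenIntegrand M (barnesG a (0 + b₀ + ∑ j ∈ s, (b j : ℂ))) t)) (Set.Ioi 0) :=
    fun s _ => ((integrableOn_malmstenIntegrand_barnesG ha (hpos q hq s)).sub
      (integrableOn_malmstenIntegrand_barnesG ha (hpos 0 h0 s))).const_mul _
  have hEq : Set.EqOn (fun t => ∑ s : Finset (Fin N),
      (-1 : ℂ) ^ s.card * (malmstenIntegrand M (barnesG a (q + b₀ + ∑ j ∈ s, (b j : ℂ))) t
        - malmstenIntegrand M (barnesG a (0 + b₀ + ∑ j ∈ s, (b j : ℂ))) t))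
      (barnesExponent a b₀ b q) (Set.Ioi 0) := by
    intro t ht
    have ht : 0 < t := ht
    have ht0 : (t : ℂ) ≠ 0 := Complex.ofReal_ne_zero.2 ht.ne'
    -- One power of `t` comes from `exp (-q t) - 1` and one from each `b j`, hence order `N + 1`.
    -- Here `h 0` is `-q` times the product of the `(a i)⁻¹` and the `b j`, and it becomes the
    -- compensator when `M = N + 1`.
    set h : ℝ → ℂ := fun t => cexpSlope q t *
      ((barnesF a t * Real.exp (-b₀ * t) * ∏ j, expSlope (b j) t : ℝ) : ℂ) with hdef
    have hh : AnalyticAt ℝ h 0 := by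
      refine (analyticAt_cexpSlope q).mul (analyticAt_ofReal_comp ?_)
      refine ((analyticAt_barnesF ha).mul (by fun_prop)).mul ?_
      exact Finset.analyticAt_fun_prod _ fun j _ => analyticAt_expSlope _
    have hpow : ∀ t : ℝ, ∑ s : Finset (Fin N), (-1 : ℂ) ^ s.card *
        (barnesG a (q + b₀ + ∑ j ∈ s, (b j : ℂ)) t - barnesG a (0 + b₀ + ∑ j ∈ s, (b j : ℂ)) t)
        = (t : ℂ) ^ (N + 1) * h t := by
      intro t
      rw [sum_barnesG_sub, ← mul_cexpSlope, hdef]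
      simp_rw [← mul_expSlope]
      rw [Finset.prod_mul_distrib]
      push_cast
      simp
      ring
    -- The Boolean separates the shift by `q` from the shift by `0`, so that the difference of the
    -- two alternating sums is a single linear combination.
    have hsum := malmstenIntegrand_sum (Finset.univ : Finset (Finset (Fin N) × Bool)) M
      (fun p => (-1 : ℂ) ^ p.1.card * if p.2 then 1 else -1)
      (fun p => barnesG a ((if p.2 then q else 0) + b₀ + ∑ j ∈ p.1, (b j : ℂ)))
      (fun p => analyticAt_barnesG ha _) t
    simp only [Fintype.sum_prod_type, Fintype.sum_bool, if_true, Bool.false_eq_true, if_false]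
      at hsum
    have e1 : ∀ x y z : ℂ, x * 1 * y + x * -1 * z = x * (y - z) := fun x y z => by ring
    simp only [e1] at hsum
    show (∑ s : Finset (Fin N), _) = _
    rw [← hsum]
    simp only [hpow]
    rw [malmstenIntegrand_pow_mul hMN hh ht, ← hpow t, sum_barnesG_sub, barnesF_of_pos a ht]
    unfold barnesExponent levyDensity barnesKernel levyCoeff
    have hh0 : h 0 = -(q * ((∏ i, (a i)⁻¹) * ∏ j, b j : ℝ)) := by
      simp only [hdef, cexpSlope_zero, barnesF, expSlope_zero, if_true]
      simp
    rw [sub_eq_add_neg]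
    congr 1
    · push_cast
      rw [pow_succ]
      field_simp
    · split_ifs
      · rw [hh0]; ring
      · simp
  refine ⟨IntegrableOn.congr_fun (integrable_finsetSum _ hint) hEq measurableSet_Ioi, ?_⟩
  rw [← setIntegral_congr_fun measurableSet_Ioi hEq, integral_finsetSum _ hint, barnesEta]
  congr 1
  unfold barnesS
  rw [← Finset.sum_sub_distrib]
  refine Finset.sum_congr rfl fun s _ => ?_
  rw [integral_const_mul, integral_sub (integrableOn_malmstenIntegrand_barnesG ha (hpos q hq s))
    (integrableOn_malmstenIntegrand_barnesG ha (hpos 0 h0 s)), logMultipleGamma_eq,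
    logMultipleGamma_eq]
  ring

/-! ### Uniform integrability and products of independent variables -/

section Convergence

variable {Ω : Type*} [MeasurableSpace Ω] {P : Measure Ω}

/-- Hölder's inequality on a set `s` bounds the `L¹` norm there by `C ^ (1 / r) * P s ^ (1 - 1 /
r)`, which is small with `P s` uniformly in the index because `r > 1`. -/
theorem unifIntegrable_of_lintegral_rpow_le [IsFiniteMeasure P] {ι : Type*} {f : ι → Ω → ℂ}
    (hf : ∀ n, AEStronglyMeasurable (f n) P) {r : ℝ} (hr : 1 < r) {C : ENNReal} (hC : C ≠ ⊤)
    (hb : ∀ n, ∫⁻ ω, ‖f n ω‖ₑ ^ r ∂P ≤ C) :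
    UnifIntegrable f 1 P ∧ ∀ n, eLpNorm (f n) 1 P ≤ C ^ (1 / r) * P Set.univ ^ (1 - 1 / r) := by
  have hr0 : 0 < r := one_pos.trans hr
  have hr1 : 0 < 1 - 1 / r := by
    rw [sub_pos, div_lt_one hr0]; exact hr
  have hrtop : ENNReal.ofReal r ≠ ⊤ := ENNReal.ofReal_ne_top
  have hrne : ENNReal.ofReal r ≠ 0 := by simpa using hr0
  have h1r : (1 : ENNReal) ≤ ENNReal.ofReal r := by
    rw [← ENNReal.ofReal_one]; exact ENNReal.ofReal_le_ofReal hr.le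
  have key : ∀ n (s : Set Ω), eLpNorm (f n) 1 (P.restrict s) ≤ C ^ (1 / r) * P s ^ (1 - 1 / r) := by
    intro n s
    refine (eLpNorm_le_eLpNorm_mul_rpow_measure_univ h1r (hf n).restrict).trans ?_
    rw [Measure.restrict_apply_univ, ENNReal.toReal_one, ENNReal.toReal_ofReal hr0.le, one_div_one]
    gcongr
    rw [eLpNorm_eq_lintegral_rpow_enorm_toReal hrne hrtop, ENNReal.toReal_ofReal hr0.le]
    gcongr
    exact (lintegral_mono' Measure.restrict_le_self le_rfl).trans (hb n)
  refine ⟨fun ε hε => ?_, fun n => by simpa using key n Set.univ⟩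
  have hCr : C ^ (1 / r) ≠ ⊤ := ENNReal.rpow_ne_top_of_nonneg (by positivity) hC
  obtain ⟨K, hK, hKpos⟩ : ∃ K : ℝ, C ^ (1 / r) ≤ ENNReal.ofReal K ∧ 0 < K := by
    refine ⟨(C ^ (1 / r)).toReal + 1, ?_, by positivity⟩
    rw [ENNReal.ofReal_add ENNReal.toReal_nonneg one_pos.le, ENNReal.ofReal_toReal hCr]
    exact le_self_add
  refine ⟨(ε / K) ^ (1 / (1 - 1 / r)), by positivity, fun n s hs hPs => ?_⟩
  rw [eLpNorm_indicator_eq_eLpNorm_restrict hs]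
  refine (key n s).trans ?_
  calc C ^ (1 / r) * P s ^ (1 - 1 / r)
      ≤ ENNReal.ofReal K * ENNReal.ofReal ((ε / K) ^ (1 / (1 - 1 / r))) ^ (1 - 1 / r) := by gcongr
    _ = ENNReal.ofReal ε := by
      rw [ENNReal.ofReal_rpow_of_pos (by positivity), ← Real.rpow_mul (by positivity),
        ← ENNReal.ofReal_mul hKpos.le, one_div_mul_cancel hr1.ne', Real.rpow_one,
        mul_div_cancel₀ _ hKpos.ne']

/-- Vitali's convergence theorem, with Fatou's lemma providing integrability of the limit. -/
theorem tendsto_integral_of_lintegral_rpow_le [IsFiniteMeasure P] {f : ℕ → Ω → ℂ} {g : Ω → ℂ}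
    (hf : ∀ n, AEStronglyMeasurable (f n) P)
    (hlim : ∀ᵐ ω ∂P, Tendsto (fun n => f n ω) atTop (𝓝 (g ω))) {r : ℝ} (hr : 1 < r)
    {C : ENNReal} (hC : C ≠ ⊤) (hb : ∀ n, ∫⁻ ω, ‖f n ω‖ₑ ^ r ∂P ≤ C) :
    Integrable g P ∧ Tendsto (fun n => ∫ ω, f n ω ∂P) atTop (𝓝 (∫ ω, g ω ∂P)) := by
  obtain ⟨hU, hB⟩ := unifIntegrable_of_lintegral_rpow_le hf hr hC hb
  have hr0 : 0 < r := one_pos.trans hr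
  have hr1 : 0 ≤ 1 - 1 / r := by
    rw [sub_nonneg, div_le_one hr0]; exact hr.le
  have hBtop : C ^ (1 / r) * P Set.univ ^ (1 - 1 / r) ≠ ⊤ :=
    ENNReal.mul_ne_top (ENNReal.rpow_ne_top_of_nonneg (by positivity) hC)
      (ENNReal.rpow_ne_top_of_nonneg hr1 (measure_ne_top _ _))
  have hgm : AEStronglyMeasurable g P := aestronglyMeasurable_of_tendsto_ae atTop hf hlim
  have hg : MemLp g 1 P := by
    refine ⟨hgm, (Lp.eLpNorm_lim_le_liminf_eLpNorm hf g hlim).trans_lt ?_⟩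
    refine lt_of_le_of_lt ?_ hBtop.lt_top
    exact liminf_le_of_le (by isBoundedDefault) fun b hb =>
      hb.exists.elim fun n hn => hn.trans (hB n)
  have hL := tendsto_Lp_finite_of_tendsto_ae le_rfl ENNReal.one_ne_top hf hg hU hlim
  refine ⟨memLp_one_iff_integrable.1 hg, tendsto_integral_of_L1' g hgm
    (Eventually.of_forall fun n => ?_) hL⟩
  exact memLp_one_iff_integrable.1 ⟨hf n, (hB n).trans_lt hBtop.lt_top⟩

theorem ProbabilityTheory.iIndepFun.integrable_fun_finset_prod {𝕜 ι : Type*} [RCLike 𝕜]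
    {X : ι → Ω → 𝕜}
    (hX : iIndepFun X P) (hi : ∀ i, Integrable (X i) P) (s : Finset ι) :
    Integrable (fun ω => ∏ i ∈ s, X i ω) P := by
  have := hX.isProbabilityMeasure
  have hs : iIndepFun (fun i : s => X i) P := hX.precomp Subtype.val_injective
  have hm : ∀ i : s, AEMeasurable (X i) P := fun i => (hi i).aemeasurable
  have hprob : ∀ i : s, IsProbabilityMeasure (P.map (X i)) :=
    fun i => Measure.isProbabilityMeasure_map (hm i)
  have h1 : Integrable (fun x : s → 𝕜 => ∏ i, x i) (Measure.pi fun i : s => P.map (X i)) :=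
    Integrable.fintype_prod (f := fun _ : s => (id : 𝕜 → 𝕜)) fun i =>
      (integrable_map_measure aestronglyMeasurable_id (hm i)).2 (hi i)
  rw [← hs.map_fun_eq_pi_map hm] at h1
  have h2 := h1.comp_aemeasurable (aemeasurable_pi_iff.2 hm)
  refine h2.congr (ae_of_all _ fun ω => ?_)
  exact Finset.prod_coe_sort s (fun i => X i ω)

theorem ProbabilityTheory.iIndepFun.integral_fun_finset_prod {𝕜 ι : Type*} [RCLike 𝕜]
    {X : ι → Ω → 𝕜} (hX : iIndepFun X P) (hi : ∀ i, AEStronglyMeasurable (X i) P) (s : Finset ι) :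
    ∫ ω, ∏ i ∈ s, X i ω ∂P = ∏ i ∈ s, ∫ ω, X i ω ∂P := by
  have hs : iIndepFun (fun i : s => X i) P := hX.precomp Subtype.val_injective
  have := hs.integral_fun_prod_eq_prod_integral fun i => hi i
  rw [← Finset.prod_coe_sort s (fun i => ∫ ω, X i ω ∂P), ← this]
  exact integral_congr_ae (ae_of_all _ fun ω => (Finset.prod_coe_sort s (fun i => X i ω)).symm)

/-- The partial products of independent nonnegative random variables of mean one converge. -/
theorem ae_exists_tendsto_prod_of_iIndepFun {Y : ℕ → Ω → ℝ} (hm : ∀ k, Measurable (Y k))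
    (hY : iIndepFun Y P) (h0 : ∀ k ω, 0 ≤ Y k ω) (hi : ∀ k, Integrable (Y k) P)
    (h1 : ∀ k, ∫ ω, Y k ω ∂P = 1) :
    ∀ᵐ ω ∂P, ∃ c, Tendsto (fun n => ∏ k ∈ Finset.range n, Y k ω) atTop (𝓝 c) := by
  have := hY.isProbabilityMeasure
  have hsm : ∀ k, StronglyMeasurable (Y k) := fun k => (hm k).stronglyMeasurable
  set F := Filtration.natural Y hsm
  -- The product runs through `Y n` so that `D n` is adapted to the natural filtration. It is a
  -- martingale of constant `L¹` norm `1`, and Doob's theorem applies.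
  set D : ℕ → Ω → ℝ := fun n ω => ∏ k ∈ Finset.range (n + 1), Y k ω
  have hDi : ∀ n, Integrable (D n) P := fun n => hY.integrable_fun_finset_prod hi _
  have hDF : StronglyAdapted F D := by
    intro n
    refine Finset.stronglyMeasurable_fun_prod _ fun k hk => ?_
    exact (Filtration.stronglyAdapted_natural hsm k).mono
      (F.mono (Nat.lt_succ_iff.1 (Finset.mem_range.1 hk)))
  have hmart : Martingale D F P := by
    refine martingale_nat hDF hDi fun n => ?_
    have e : D (n + 1) = D n * Y (n + 1) := by
      ext ω; exact Finset.prod_range_succ _ _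
    have h2 := condExp_mul_of_stronglyMeasurable_left (hDF n)
      (by rw [← e]; exact hDi (n + 1)) (hi (n + 1))
    rw [e]
    filter_upwards [h2, hY.condExp_natural_ae_eq_of_lt hsm (Nat.lt_succ_self n)] with ω hω hω'
    rw [hω, Pi.mul_apply, hω', h1, mul_one]
  have hb : ∀ n, eLpNorm (D n) 1 P ≤ (1 : NNReal) := by
    intro n
    have hn : 0 ≤ᵐ[P] D n := ae_of_all _ fun ω => Finset.prod_nonneg fun k _ => h0 k ω
    have h3 : ∫ ω, D n ω ∂P = 1 := by
      rw [hY.integral_fun_finset_prod fun k => (hsm k).aestronglyMeasurable]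
      simp [h1]
    rw [eLpNorm_one_eq_lintegral_enorm, ← ofReal_integral_norm_eq_lintegral_enorm (hDi n)]
    rw [integral_congr_ae (hn.mono fun ω hω => Real.norm_of_nonneg hω), h3]
    simp
  filter_upwards [hmart.submartingale.ae_tendsto_limitProcess hb] with ω hω
  exact ⟨_, (tendsto_add_atTop_iff_nat 1).1 hω⟩

end Convergence

/-! ### Sums of independent variables with summable log-moments -/

/-- A family of independent random variables whose exponential moments on the strip `re q ∈ I`
are `exp (ψ i q)`, with `ψ` summable to `Ψ`. -/
structure IsSummableFamily {Ω ι : Type*} [MeasurableSpace Ω] (P : Measure Ω) (W : ι → Ω → ℝ)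
    (I : Set ℝ) (ψ : ι → ℂ → ℂ) (Ψ : ℂ → ℂ) : Prop where
  measurable : ∀ i, Measurable (W i)
  indep : iIndepFun W P
  isOpen : IsOpen I
  zero_mem : (0 : ℝ) ∈ I
  integrable : ∀ i q, q.re ∈ I → Integrable (fun ω => Complex.exp (q * W i ω)) P
  integral : ∀ i q, q.re ∈ I → ∫ ω, Complex.exp (q * W i ω) ∂P = Complex.exp (ψ i q)
  hasSum : ∀ q, q.re ∈ I → HasSum (fun i => ψ i q) (Ψ q)

namespace IsSummableFamily

variable {Ω ι : Type*} [MeasurableSpace Ω] {P : Measure Ω} {W : ι → Ω → ℝ}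
    {I : Set ℝ} {ψ : ι → ℂ → ℂ} {Ψ : ℂ → ℂ}

theorem comp_equiv (h : IsSummableFamily P W I ψ Ψ) {κ : Type*} (e : κ ≃ ι) :
    IsSummableFamily P (fun k => W (e k)) I (fun k => ψ (e k)) Ψ where
  measurable _ := h.measurable _
  indep := h.indep.precomp e.injective
  isOpen := h.isOpen
  zero_mem := h.zero_mem
  integrable _ := h.integrable _
  integral _ := h.integral _
  hasSum q hq := (e.hasSum_iff (f := fun i => ψ i q)).2 (h.hasSum q hq)

/-- The exponent may vary with the index; comparing two enumerations requires opposite signs on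
different indices. -/
theorem integral_exp_sum (h : IsSummableFamily P W I ψ Ψ) (s : Finset ι) (z : ι → ℂ)
    (hz : ∀ i, (z i).re ∈ I) :
    Integrable (fun ω => Complex.exp (∑ i ∈ s, z i * W i ω)) P ∧
      ∫ ω, Complex.exp (∑ i ∈ s, z i * W i ω) ∂P = Complex.exp (∑ i ∈ s, ψ i (z i)) := by
  have hX : iIndepFun (fun i ω => Complex.exp (z i * W i ω)) P :=
    h.indep.comp (fun i x => Complex.exp (z i * x)) fun i => by fun_prop
  simp only [Complex.exp_sum]
  refine ⟨hX.integrable_fun_finset_prod (fun i => h.integrable i _ (hz i)) s, ?_⟩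
  rw [hX.integral_fun_finset_prod (fun i => (h.integrable i _ (hz i)).aestronglyMeasurable) s]
  exact Finset.prod_congr rfl fun i _ => h.integral i _ (hz i)

/-- The numbers `ψ i p` are logarithms only up to `2πi` and need not be real; taking norms leaves
just their real parts. -/
theorem integral_real_exp (h : IsSummableFamily P W I ψ Ψ) (s : Finset ι) {p : ℝ} (hp : p ∈ I) :
    Integrable (fun ω => Real.exp (p * ∑ i ∈ s, W i ω)) P ∧
      ∫ ω, Real.exp (p * ∑ i ∈ s, W i ω) ∂P = Real.exp (∑ i ∈ s, ψ i p).re := by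
  obtain ⟨h1, h2⟩ := h.integral_exp_sum s (fun _ => (p : ℂ)) (fun _ => by simpa using hp)
  have e : ∀ ω, Complex.exp (∑ i ∈ s, (p : ℂ) * W i ω)
      = ((Real.exp (p * ∑ i ∈ s, W i ω) : ℝ) : ℂ) := by
    intro ω; push_cast; rw [Finset.mul_sum]
  simp only [e] at h1 h2
  have h3 : Integrable (fun ω => Real.exp (p * ∑ i ∈ s, W i ω)) P := by
    exact h1.re
  refine ⟨h3, ?_⟩
  rw [integral_complex_ofReal] at h2
  have h4 : 0 ≤ ∫ ω, Real.exp (p * ∑ i ∈ s, W i ω) ∂P := integral_nonneg fun ω => (Real.exp_pos _).le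
  have h5 := congrArg norm h2
  rwa [Complex.norm_real, Real.norm_of_nonneg h4, Complex.norm_exp] at h5

/-- Divided by their means, the factors form a martingale product; the product of the means
converges since the `ψ k p` are summable. -/
theorem ae_exists_tendsto_exp {W : ℕ → Ω → ℝ} {ψ : ℕ → ℂ → ℂ} (h : IsSummableFamily P W I ψ Ψ)
    {p : ℝ} (hp : p ∈ I) :
    ∀ᵐ ω ∂P, ∃ c, Tendsto (fun n => Real.exp (p * ∑ k ∈ Finset.range n, W k ω)) atTop (𝓝 c) := by
  set m : ℕ → ℝ := fun k => Real.exp (ψ k p).re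
  have hmpos : ∀ k, 0 < m k := fun k => Real.exp_pos _
  have hone : ∀ k, Integrable (fun ω => Real.exp (p * W k ω)) P ∧
      ∫ ω, Real.exp (p * W k ω) ∂P = m k := fun k => by
    simpa using h.integral_real_exp {k} hp
  have hY := ae_exists_tendsto_prod_of_iIndepFun (P := P)
    (Y := fun k ω => Real.exp (p * W k ω) / m k)
    (fun k => by have := h.measurable k; fun_prop)
    (h.indep.comp (fun k x => Real.exp (p * x) / m k) fun k => by fun_prop)
    (fun k ω => div_nonneg (Real.exp_pos _).le (hmpos k).le) (fun k => (hone k).1.div_const _)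
    (fun k => by rw [integral_div, (hone k).2, div_self (hmpos k).ne'])
  have hlim : Tendsto (fun n => ∏ k ∈ Finset.range n, m k) atTop (𝓝 (Real.exp (Ψ p).re)) := by
    have h1 := (h.hasSum p (by simpa using hp)).tendsto_sum_nat
    have h2 := (Real.continuous_exp.comp Complex.continuous_re).continuousAt.tendsto.comp h1
    refine h2.congr fun n => ?_
    simp [m, Complex.re_sum, Real.exp_sum]
  filter_upwards [hY] with ω ⟨c, hc⟩
  refine ⟨c * Real.exp (Ψ p).re, (hc.mul hlim).congr fun n => ?_⟩
  rw [← Finset.prod_mul_distrib, Finset.mul_sum, Real.exp_sum]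
  exact Finset.prod_congr rfl fun k _ => div_mul_cancel₀ _ (hmpos k).ne'

/-- The exponentials of `±p` times the partial sums both converge, and their product is `1`. The
limit is thus nonzero and a logarithm can be taken. -/
theorem ae_exists_tendsto {W : ℕ → Ω → ℝ} {ψ : ℕ → ℂ → ℂ} (h : IsSummableFamily P W I ψ Ψ) :
    ∀ᵐ ω ∂P, ∃ c, Tendsto (fun n => ∑ k ∈ Finset.range n, W k ω) atTop (𝓝 c) := by
  obtain ⟨δ, hδ, hball⟩ := Metric.isOpen_iff.1 h.isOpen 0 h.zero_mem
  have hp : δ / 2 ∈ I := hball (by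
    rw [Metric.mem_ball, Real.dist_eq, sub_zero, abs_of_pos (half_pos hδ)]; linarith)
  have hn : -(δ / 2) ∈ I := hball (by
    rw [Metric.mem_ball, Real.dist_eq, sub_zero, abs_neg, abs_of_pos (half_pos hδ)]; linarith)
  filter_upwards [h.ae_exists_tendsto_exp hp, h.ae_exists_tendsto_exp hn] with ω ⟨c, hc⟩ ⟨d, hd⟩
  have hcd : c * d = 1 := by
    refine tendsto_nhds_unique (hc.mul hd) (tendsto_const_nhds.congr fun n => ?_)
    rw [← Real.exp_add]; simp
  have hc0 : c ≠ 0 := left_ne_zero_of_mul_eq_one hcd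
  refine ⟨(δ / 2)⁻¹ * Real.log c, ((hc.log hc0).const_mul (δ / 2)⁻¹).congr fun n => ?_⟩
  rw [Real.log_exp, inv_mul_cancel_left₀ (half_pos hδ).ne']

theorem tendsto_integral_exp_sub (h : IsSummableFamily P W I ψ Ψ) (e e' : ℕ ≃ ι) (θ : ℝ) :
    Tendsto (fun n => ∫ ω, Complex.exp ((θ * Complex.I) *
      ((∑ k ∈ Finset.range n, W (e k) ω - ∑ k ∈ Finset.range n, W (e' k) ω : ℝ) : ℂ)) ∂P)
      atTop (𝓝 1) := by
  classical
  set A : ℕ → Finset ι := fun n => (Finset.range n).map e.toEmbedding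
  set B : ℕ → Finset ι := fun n => (Finset.range n).map e'.toEmbedding
  have hre : ∀ x : ℝ, ((x : ℂ) * Complex.I).re ∈ I := fun x => by simpa using h.zero_mem
  have hsub : ∀ n, ∫ ω, Complex.exp ((θ * Complex.I) *
      ((∑ k ∈ Finset.range n, W (e k) ω - ∑ k ∈ Finset.range n, W (e' k) ω : ℝ) : ℂ)) ∂P
      = Complex.exp (∑ i ∈ A n \ B n, ψ i (θ * Complex.I)
        + ∑ i ∈ B n \ A n, ψ i ((-θ : ℝ) * Complex.I)) := by
    intro n
    have hdis : Disjoint (A n \ B n) (B n \ A n) := disjoint_sdiff_sdiff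
    -- Common indices cancel in the difference, leaving exponent `iθ` on `A n \ B n` and `-iθ` on `B
    -- n \ A n`.
    have h1 := (h.integral_exp_sum (A n \ B n ∪ B n \ A n)
      (fun i => ((if i ∈ A n then θ else -θ : ℝ) : ℂ) * Complex.I) fun i => hre _).2
    have hA : ∀ f : ι → ℂ → ℂ, ∑ i ∈ A n \ B n,
        f i (((if i ∈ A n then θ else -θ : ℝ) : ℂ) * Complex.I)
        = ∑ i ∈ A n \ B n, f i (θ * Complex.I) := fun f =>
      Finset.sum_congr rfl fun i hi => by rw [if_pos (Finset.mem_sdiff.1 hi).1]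
    have hB : ∀ f : ι → ℂ → ℂ, ∑ i ∈ B n \ A n,
        f i (((if i ∈ A n then θ else -θ : ℝ) : ℂ) * Complex.I)
        = ∑ i ∈ B n \ A n, f i ((-θ : ℝ) * Complex.I) := fun f =>
      Finset.sum_congr rfl fun i hi => by rw [if_neg (Finset.mem_sdiff.1 hi).2]
    rw [Finset.sum_union hdis, hA ψ, hB ψ] at h1
    rw [← h1]
    refine integral_congr_ae (ae_of_all _ fun ω => ?_)
    simp only
    rw [Finset.sum_union hdis, hA fun i z => z * (W i ω : ℂ), hB fun i z => z * (W i ω : ℂ)]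
    congr 1
    have e1 : ∑ k ∈ Finset.range n, W (e k) ω = ∑ i ∈ A n, W i ω := by simp [A]
    have e2 : ∑ k ∈ Finset.range n, W (e' k) ω = ∑ i ∈ B n, W i ω := by simp [B]
    have e3 : ∑ i ∈ A n, W i ω - ∑ i ∈ B n, W i ω
        = ∑ i ∈ A n \ B n, W i ω - ∑ i ∈ B n \ A n, W i ω := by
      rw [Finset.sum_sdiff_sub_sum_sdiff]
    rw [e1, e2, e3, ← Finset.mul_sum, ← Finset.mul_sum]
    push_cast
    ring
  simp_rw [hsub]
  -- The first `n` indices of `g` eventually contain any given finite set, so these differences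
  -- avoid it and the Cauchy criterion for unconditional sums applies.
  have htail : ∀ (f g : ℕ ≃ ι) (x : ℝ), Tendsto (fun n => ∑ i ∈ (Finset.range n).map f.toEmbedding \
      (Finset.range n).map g.toEmbedding, ψ i (x * Complex.I)) atTop (𝓝 0) := by
    intro f g x
    rw [Metric.tendsto_atTop]
    intro ε hε
    obtain ⟨s, hs⟩ := summable_iff_vanishing_norm.1 (h.hasSum _ (hre x)).summable ε hε
    obtain ⟨N, hN⟩ : ∃ N, ∀ i ∈ s, g.symm i < N := by
      refine ⟨(s.sup fun i => g.symm i) + 1, fun i hi => Nat.lt_succ_of_le ?_⟩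
      exact Finset.le_sup (f := fun i => g.symm i) hi
    refine ⟨N, fun n hn => ?_⟩
    rw [dist_zero_right]
    refine hs _ ?_
    rw [Finset.disjoint_left]
    intro i hi his
    refine (Finset.mem_sdiff.1 hi).2 (Finset.mem_map.2 ⟨g.symm i, ?_, by simp⟩)
    exact Finset.mem_range.2 ((hN i his).trans_le hn)
  have := ((htail e e' θ).add (htail e' e (-θ))).cexp
  simpa using this

/-- The sum of the family along every enumeration converges almost surely, to a limit which does
not depend on the enumeration and has exponential moments `exp (Ψ q)`. -/
theorem exists_tendsto [Countable ι] [Infinite ι] (h : IsSummableFamily P W I ψ Ψ) :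
    ∃ Z : Ω → ℝ, Measurable Z ∧
      (∀ e : ℕ ≃ ι, ∀ᵐ ω ∂P,
        Tendsto (fun n => ∑ k ∈ Finset.range n, W (e k) ω) atTop (𝓝 (Z ω))) ∧
      ∀ q : ℂ, q.re ∈ I → Integrable (fun ω => Complex.exp (q * Z ω)) P ∧
        ∫ ω, Complex.exp (q * Z ω) ∂P = Complex.exp (Ψ q) := by
  have := h.indep.isProbabilityMeasure
  obtain ⟨e₀⟩ : Nonempty (ℕ ≃ ι) := by
    obtain ⟨d⟩ := nonempty_denumerable ι
    exact ⟨(Denumerable.eqv ι).symm⟩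
  have hmeas : ∀ (e : ℕ ≃ ι) n, Measurable fun ω => ∑ k ∈ Finset.range n, W (e k) ω := fun e n =>
    Finset.measurable_fun_sum _ fun k _ => h.measurable _
  have hlim : ∀ e : ℕ ≃ ι, ∃ Z : Ω → ℝ, Measurable Z ∧ ∀ᵐ ω ∂P,
      Tendsto (fun n => ∑ k ∈ Finset.range n, W (e k) ω) atTop (𝓝 (Z ω)) := fun e =>
    measurable_limit_of_tendsto_metrizable_ae (fun n => (hmeas e n).aemeasurable)
      (h.comp_equiv e).ae_exists_tendsto
  obtain ⟨Z, hZm, hZ⟩ := hlim e₀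
  refine ⟨Z, hZm, fun e => ?_, fun q hq => ?_⟩
  · obtain ⟨Z', hZm', hZ'⟩ := hlim e
    have hZd : Measurable fun ω => Z' ω - Z ω := hZm'.sub hZm
    -- The limits along two enumerations differ by a variable with characteristic function
    -- identically `1`.
    have hdiff : P.map (fun ω => Z' ω - Z ω) = Measure.dirac 0 := by
      have := Measure.isProbabilityMeasure_map (μ := P) hZd.aemeasurable
      refine Measure.ext_of_charFun (funext fun θ => ?_)
      rw [charFun_apply_real, charFun_apply_real, integral_map hZd.aemeasurable
        (by fun_prop), integral_dirac]
      simp only [Complex.ofReal_zero, mul_zero, zero_mul, Complex.exp_zero]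
      refine tendsto_nhds_unique ?_ (h.tendsto_integral_exp_sub e e₀ θ)
      refine tendsto_integral_of_dominated_convergence (fun _ => (1 : ℝ)) (fun n => ?_)
        (integrable_const _) (fun n => ae_of_all _ fun ω => ?_) ?_
      · have h1 := hmeas e n
        have h2 := hmeas e₀ n
        exact Measurable.aestronglyMeasurable (by fun_prop)
      · rw [mul_assoc, mul_comm Complex.I, ← mul_assoc, ← Complex.ofReal_mul,
          Complex.norm_exp_ofReal_mul_I]
      · filter_upwards [hZ, hZ'] with ω hω hω'
        have hc : Continuous fun x : ℝ => Complex.exp ((θ * Complex.I) * (x : ℂ)) := by fun_prop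
        have := (hc.tendsto _).comp (hω'.sub hω)
        convert! this using 2
        ring_nf
    have hae : ∀ᵐ ω ∂P, Z' ω - Z ω = 0 := by
      have h1 : ∀ᵐ x ∂(P.map fun ω => Z' ω - Z ω), x = 0 := by
        rw [hdiff, ae_dirac_eq]
        exact rfl
      exact ae_of_ae_map hZd.aemeasurable h1
    filter_upwards [hZ', hae] with ω hω h0
    rwa [← sub_eq_zero.1 h0]
  -- Openness of `I` leaves room for an exponent `r > 1`; the `r`-th absolute moments of `exp (q
  -- S_n)` are then moments at `r * q.re`, bounded because they converge.
  · obtain ⟨r, hr, hrI⟩ : ∃ r : ℝ, 1 < r ∧ r * q.re ∈ I := by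
      have hc : ContinuousAt (fun r : ℝ => r * q.re) 1 := by fun_prop
      have h1 : ∀ᶠ r : ℝ in 𝓝 1, r * q.re ∈ I := by
        refine hc.eventually (h.isOpen.mem_nhds ?_)
        simpa using hq
      have h2 : ∀ᶠ r : ℝ in 𝓝[>] 1, r * q.re ∈ I := h1.filter_mono nhdsWithin_le_nhds
      obtain ⟨r, hr, hr'⟩ := (h2.and self_mem_nhdsWithin).exists
      exact ⟨r, hr', hr⟩
    have h' := h.comp_equiv e₀
    have hsum : ∀ n, ∫ ω, Complex.exp (q * (∑ k ∈ Finset.range n, W (e₀ k) ω : ℝ)) ∂P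
        = Complex.exp (∑ k ∈ Finset.range n, ψ (e₀ k) q) := by
      intro n
      rw [← (h'.integral_exp_sum (Finset.range n) (fun _ => q) fun _ => hq).2]
      refine integral_congr_ae (ae_of_all _ fun ω => ?_)
      simp only
      rw [← Finset.mul_sum]
      push_cast
      rfl
    obtain ⟨C, hC⟩ : ∃ C : ℝ, ∀ n,
        Real.exp (∑ k ∈ Finset.range n, ψ (e₀ k) (r * q.re : ℝ)).re ≤ C := by
      have h1 := (h'.hasSum ((r * q.re : ℝ) : ℂ) (by simpa using hrI)).tendsto_sum_nat
      have h2 := (Real.continuous_exp.comp Complex.continuous_re).continuousAt.tendsto.comp h1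
      obtain ⟨C, hC⟩ := h2.bddAbove_range
      exact ⟨C, fun n => hC ⟨n, rfl⟩⟩
    obtain ⟨hi, ht⟩ := tendsto_integral_of_lintegral_rpow_le (P := P)
      (f := fun n ω => Complex.exp (q * (∑ k ∈ Finset.range n, W (e₀ k) ω : ℝ)))
      (g := fun ω => Complex.exp (q * Z ω)) (r := r) (C := ENNReal.ofReal C)
      (fun n => by
        have h1 := hmeas e₀ n
        exact Measurable.aestronglyMeasurable (by fun_prop))
      (by
        filter_upwards [hZ] with ω hω
        have hc : Continuous fun x : ℝ => Complex.exp (q * (x : ℂ)) := by fun_prop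
        exact (hc.tendsto _).comp hω)
      hr ENNReal.ofReal_ne_top
      (fun n => by
        obtain ⟨h1, h2⟩ := h'.integral_real_exp (Finset.range n) hrI
        refine le_trans (le_of_eq ?_) (ENNReal.ofReal_le_ofReal (hC n))
        rw [← h2, ofReal_integral_eq_lintegral_ofReal h1 (ae_of_all _ fun ω => (Real.exp_pos _).le)]
        refine lintegral_congr fun ω => ?_
        rw [← ofReal_norm, Complex.norm_exp,
          ENNReal.ofReal_rpow_of_pos (Real.exp_pos _), ← Real.exp_mul]
        congr 2
        simp only [Complex.mul_re, Complex.ofReal_re, Complex.ofReal_im, mul_zero, sub_zero]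
        ring)
    refine ⟨hi, tendsto_nhds_unique ht ?_⟩
    simp_rw [hsum]
    exact ((h'.hasSum q hq).tendsto_sum_nat).cexp

end IsSummableFamily

/-! ### Compound Poisson laws and Lévy–Khintchine existence -/

/-- The compound Poisson law with Lévy measure `ν`. -/
def compoundPoisson (ν : Measure ℝ) : Measure ℝ :=
  Measure.sum fun k : ℕ => ENNReal.ofReal (Real.exp (-ν.real Set.univ) / k.factorial) •
    (Measure.pi fun _ : Fin k => ν).map fun x => ∑ i, x i

/-- The `k`-fold convolution contributes the `k`-th power of the transform of `ν`, and the Poisson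
weights sum these powers to an exponential series. -/
theorem integral_cexp_compoundPoisson (ν : Measure ℝ) [IsFiniteMeasure ν] {q : ℂ}
    (hq : Integrable (fun x : ℝ => Complex.exp (q * x)) ν) :
    Integrable (fun x : ℝ => Complex.exp (q * x)) (compoundPoisson ν) ∧
      ∫ x : ℝ, Complex.exp (q * x) ∂(compoundPoisson ν)
        = Complex.exp (∫ x : ℝ, (Complex.exp (q * x) - 1) ∂ν) := by
  set c : ℕ → ℝ := fun k => Real.exp (-ν.real Set.univ) / k.factorial
  have hc : ∀ k, 0 ≤ c k := fun k => by positivity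
  have hsm : ∀ k : ℕ, Measurable fun x : Fin k → ℝ => ∑ i, x i := fun k => by fun_prop
  have hpow : ∀ (k : ℕ) (x : Fin k → ℝ), Complex.exp (q * ((∑ i, x i : ℝ) : ℂ))
      = ∏ i, Complex.exp (q * x i) := by
    intro k x
    rw [← Complex.exp_sum, ← Finset.mul_sum]
    push_cast
    rfl
  have hpown : ∀ (k : ℕ) (x : Fin k → ℝ), ‖Complex.exp (q * ((∑ i, x i : ℝ) : ℂ))‖
      = ∏ i, ‖Complex.exp (q * x i)‖ := by
    intro k x
    rw [hpow, norm_prod]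
  have hint : ∀ k : ℕ, Integrable (fun x : ℝ => Complex.exp (q * x))
      ((Measure.pi fun _ : Fin k => ν).map fun x => ∑ i, x i) := by
    intro k
    rw [integrable_map_measure (by fun_prop) (hsm k).aemeasurable]
    refine (Integrable.fintype_prod (f := fun _ : Fin k => fun x : ℝ => Complex.exp (q * x))
      fun _ => hq).congr (ae_of_all _ fun x => ?_)
    exact (hpow k x).symm
  have hnorm : ∀ k : ℕ, ∫ x : ℝ, ‖Complex.exp (q * x)‖
      ∂((Measure.pi fun _ : Fin k => ν).map fun x => ∑ i, x i)
      = (∫ x : ℝ, ‖Complex.exp (q * x)‖ ∂ν) ^ k := by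
    intro k
    rw [integral_map (hsm k).aemeasurable (by fun_prop)]
    simp_rw [hpown]
    rw [integral_fintype_prod_eq_pow (fun x : ℝ => ‖Complex.exp (q * x)‖), Fintype.card_fin]
  have hval : ∀ k : ℕ, ∫ x : ℝ, Complex.exp (q * x)
      ∂((Measure.pi fun _ : Fin k => ν).map fun x => ∑ i, x i)
      = (∫ x : ℝ, Complex.exp (q * x) ∂ν) ^ k := by
    intro k
    rw [integral_map (hsm k).aemeasurable (by fun_prop)]
    simp_rw [hpow]
    rw [integral_fintype_prod_eq_pow (fun x : ℝ => Complex.exp (q * x)), Fintype.card_fin]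
  have hI : Integrable (fun x : ℝ => Complex.exp (q * x)) (compoundPoisson ν) := by
    refine integrable_sum_measure (fun k => (hint k).smul_measure ENNReal.ofReal_ne_top) ?_
    simp_rw [integral_smul_measure, hnorm]
    have := (Real.summable_pow_div_factorial (∫ x : ℝ, ‖Complex.exp (q * x)‖ ∂ν)).mul_left
      (Real.exp (-ν.real Set.univ))
    refine this.congr fun k => ?_
    rw [ENNReal.toReal_ofReal (hc k), smul_eq_mul]
    simp only [c]
    ring
  refine ⟨hI, ?_⟩
  have h1 := hasSum_integral_measure hI
  simp_rw [integral_smul_measure, hval] at h1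
  have h2 := (NormedSpace.expSeries_div_hasSum_exp (∫ x : ℝ, Complex.exp (q * x) ∂ν)).mul_left
    (Complex.exp (-ν.real Set.univ))
  rw [← Complex.exp_eq_exp_ℂ, ← Complex.exp_add] at h2
  rw [integral_sub hq (integrable_const _), integral_const]
  refine (h1.unique (h2.congr_fun fun k => ?_)).trans ?_
  · rw [ENNReal.toReal_ofReal (hc k), Complex.real_smul]
    simp only [c]
    push_cast
    ring
  · congr 1
    simp
    ring

theorem isProbabilityMeasure_compoundPoisson (ν : Measure ℝ) [IsFiniteMeasure ν] :
    IsProbabilityMeasure (compoundPoisson ν) := by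
  obtain ⟨h1, h2⟩ := integral_cexp_compoundPoisson ν (q := 0) (by simp)
  simp only [zero_mul, Complex.exp_zero, sub_self, integral_zero, integrable_const_iff] at h1 h2
  have hfin : IsFiniteMeasure (compoundPoisson ν) := by simpa using h1
  rw [integral_const, Complex.real_smul, mul_one] at h2
  have h3 : (compoundPoisson ν).real Set.univ = 1 := by exact_mod_cast h2
  exact ⟨by rw [← ENNReal.toReal_eq_one_iff]; exact h3⟩

/-- Mean value inequality on the segment from `0` to `z`, where real parts do not exceed `max 0
z.re`. -/
theorem norm_cexp_sub_one_le (z : ℂ) : ‖Complex.exp z - 1‖ ≤ ‖z‖ * Real.exp (max 0 z.re) := by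
  have h := Convex.norm_image_sub_le_of_norm_deriv_le (f := Complex.exp)
    (s := segment ℝ 0 z) (x := 0) (y := z) (C := Real.exp (max 0 z.re))
    (fun x _ => Complex.differentiable_exp x) (fun x hx => ?_) (convex_segment 0 z)
    (left_mem_segment ℝ 0 z) (right_mem_segment ℝ 0 z)
  · simpa [mul_comm] using h
  · rw [Complex.deriv_exp, Complex.norm_exp]
    obtain ⟨s, t, hs, ht, hst, rfl⟩ := hx
    refine Real.exp_le_exp.2 ?_
    simp only [smul_zero, zero_add, Complex.smul_re, smul_eq_mul]
    rcases le_total 0 z.re with h0 | h0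
    · rw [max_eq_right h0]; nlinarith
    · rw [max_eq_left h0]; nlinarith

theorem norm_cexp_sub_one_sub_le (z : ℂ) :
    ‖Complex.exp z - 1 - z‖ ≤ ‖z‖ ^ 2 * Real.exp (max 0 z.re) := by
  have hd : ∀ x : ℂ, HasDerivAt (fun z => Complex.exp z - 1 - z) (Complex.exp x - 1) x := fun x =>
    ((Complex.hasDerivAt_exp x).sub_const 1).sub (hasDerivAt_id x)
  have h := Convex.norm_image_sub_le_of_norm_deriv_le (f := fun z => Complex.exp z - 1 - z)
    (s := segment ℝ 0 z) (x := 0) (y := z) (C := ‖z‖ * Real.exp (max 0 z.re))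
    (fun x _ => (hd x).differentiableAt) (fun x hx => ?_) (convex_segment 0 z)
    (left_mem_segment ℝ 0 z) (right_mem_segment ℝ 0 z)
  · refine le_trans (by simp) (h.trans (le_of_eq ?_))
    rw [sub_zero]; ring
  · rw [(hd x).deriv]
    refine (norm_cexp_sub_one_le x).trans ?_
    obtain ⟨s, t, hs, ht, hst, rfl⟩ := hx
    have ht1 : t ≤ 1 := by linarith
    simp only [smul_zero, zero_add, Complex.smul_re, smul_eq_mul, norm_smul]
    rw [Real.norm_of_nonneg ht]
    have hmax : max 0 (t * z.re) ≤ max 0 z.re := by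
      rcases le_total 0 z.re with h0 | h0
      · rw [max_eq_right h0]; exact max_le h0 (by nlinarith)
      · rw [max_eq_left h0]; exact max_le le_rfl (by nlinarith)
    exact mul_le_mul (by nlinarith [norm_nonneg z]) (Real.exp_le_exp.2 hmax) (Real.exp_pos _).le
      (norm_nonneg z)

/-- Integration against a partition of unity. -/
theorem hasSum_integral_mul_of_hasSum_one {α ι : Type*} [Countable ι] [MeasurableSpace α]
    {μ : Measure α} {w : ι → α → ℝ} (hw : ∀ n, Measurable (w n))
    (h0 : ∀ᵐ t ∂μ, ∀ n, 0 ≤ w n t) (h1 : ∀ᵐ t ∂μ, HasSum (fun n => w n t) 1) {R : α → ℂ}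
    (hR : Integrable R μ) :
    HasSum (fun n => ∫ t, w n t * R t ∂μ) (∫ t, R t ∂μ) := by
  have hs : ∀ᵐ t ∂μ, HasSum (fun n => w n t * ‖R t‖) ‖R t‖ := by
    filter_upwards [h1] with t ht
    simpa using ht.mul_right ‖R t‖
  refine hasSum_integral_of_dominated_convergence (fun n t => w n t * ‖R t‖) (fun n => ?_)
    (fun n => ?_) (hs.mono fun t ht => ht.summable) ?_ ?_
  · exact (Complex.measurable_ofReal.comp (hw n)).aestronglyMeasurable.mul hR.aestronglyMeasurable
  · filter_upwards [h0] with t ht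
    rw [norm_mul, Complex.norm_real, Real.norm_of_nonneg (ht n)]
  · exact hR.norm.congr (hs.mono fun t ht => ht.tsum_eq.symm)
  · filter_upwards [h1] with t ht
    simpa using (Complex.hasSum_ofReal.2 ht).mul_right (R t)

theorem integrable_levyKhintchine {ρ : ℝ → ℝ} (hm : Measurable ρ) (h0 : ∀ t, 0 < t → 0 ≤ ρ t)
    {β : ℝ} (hβ : 0 < β)
    (hρ : ∀ s < β, IntegrableOn (fun t => t ^ 2 * Real.exp (s * t) * ρ t) (Set.Ioi 0))
    {q : ℂ} (hq : -β < q.re) :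
    IntegrableOn (fun t : ℝ => (Complex.exp (-q * t) - 1 + q * t) * ρ t) (Set.Ioi 0) := by
  have hs : max 0 (-q.re) < β := max_lt hβ (by linarith)
  refine Integrable.mono' ((hρ _ hs).const_mul (‖q‖ ^ 2)) ?_ ?_
  · exact Measurable.aestronglyMeasurable (by fun_prop)
  · refine (ae_restrict_iff' measurableSet_Ioi).2 (ae_of_all _ fun t ht => ?_)
    have ht : 0 < t := ht
    rw [norm_mul, Complex.norm_real, Real.norm_of_nonneg (h0 t ht)]
    have h1 := norm_cexp_sub_one_sub_le (-q * t)
    have e1 : Complex.exp (-q * t) - 1 - -q * t = Complex.exp (-q * t) - 1 + q * t := by ring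
    have e2 : max 0 (-q * t : ℂ).re = max 0 (-q.re) * t := by
      have : (-q * t : ℂ).re = -q.re * t := by simp
      rw [this, max_mul_of_nonneg _ _ ht.le, zero_mul]
    have e3 : ‖-q * (t : ℂ)‖ = ‖q‖ * t := by
      rw [norm_mul, norm_neg, Complex.norm_real, Real.norm_of_nonneg ht.le]
    rw [e1, e2, e3] at h1
    calc _ ≤ (‖q‖ * t) ^ 2 * Real.exp (max 0 (-q.re) * t) * ρ t := by
          gcongr; exact h0 t ht
      _ = _ := by ring

/-- Existence of the infinitely divisible law with Lévy density `ρ` on `(0, ∞)`, reflected and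
centered, under a second moment condition. -/
theorem exists_levyKhintchine {ρ : ℝ → ℝ} (hm : Measurable ρ) (h0 : ∀ t, 0 < t → 0 ≤ ρ t)
    {β : ℝ} (hβ : 0 < β)
    (hρ : ∀ s < β, IntegrableOn (fun t => t ^ 2 * Real.exp (s * t) * ρ t) (Set.Ioi 0)) :
    ∃ μ : Measure ℝ, IsProbabilityMeasure μ ∧ ∀ q : ℂ, -β < q.re →
      Integrable (fun x : ℝ => Complex.exp (q * x)) μ ∧
        ∫ x : ℝ, Complex.exp (q * x) ∂μ
          = Complex.exp (∫ t in Set.Ioi (0 : ℝ),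
              (Complex.exp (-q * t) - 1 + q * t) * ρ t) := by
  -- Slice `(0, ∞)` by the integer part of `1 / t`. On slice `n` one has `(n + 1) t ≥ 1`, so the
  -- second moment condition bounds the mass, the mean and the exponential moments of the restricted
  -- Lévy measure.
  set w : ℕ → ℝ → ℝ := fun n t => if ⌊t⁻¹⌋₊ = n then 1 else 0 with hwdef
  have hw : ∀ n, Measurable (w n) := fun n => by
    refine Measurable.ite ?_ measurable_const measurable_const
    exact (Nat.measurable_floor.comp measurable_inv) (measurableSet_singleton n)
  have hw0 : ∀ n t, 0 ≤ w n t := fun n t => by simp only [hwdef]; split_ifs <;> norm_num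
  have hw1 : ∀ t, HasSum (fun n => w n t) 1 := fun t => by
    simp only [hwdef]
    convert! hasSum_ite_eq ⌊t⁻¹⌋₊ (1 : ℝ) using 3
    exact eq_comm
  have hwb : ∀ n t, 0 < t → w n t ≤ (n + 1) * t ∧ w n t ≤ (n + 1) ^ 2 * t ^ 2 := by
    intro n t ht
    simp only [hwdef]
    split_ifs with h
    · have h1 : t⁻¹ < n + 1 := by rw [← h]; exact Nat.lt_floor_add_one _
      have h2 : 1 ≤ (n + 1) * t := by
        rw [inv_eq_one_div, div_lt_iff₀ ht] at h1; exact h1.le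
      exact ⟨h2, by nlinarith⟩
    · exact ⟨by positivity, by positivity⟩
  set V : Measure ℝ := volume.restrict (Set.Ioi 0) with hV
  have hpos : ∀ᵐ t ∂V, 0 < t := ae_restrict_mem measurableSet_Ioi
  set g : ℕ → ℝ → ENNReal := fun n t => ENNReal.ofReal (w n t * ρ t)
  have hg : ∀ n, Measurable (g n) := fun n => by have := hw n; fun_prop
  set ν : ℕ → Measure ℝ := fun n => V.withDensity (g n)
  have hgr : ∀ n, ∀ᵐ t ∂V, (g n t).toReal = w n t * ρ t := fun n => by
    filter_upwards [hpos] with t ht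
    exact ENNReal.toReal_ofReal (mul_nonneg (hw0 n t) (h0 t ht))
  have hνi : ∀ n (f : ℝ → ℂ), Integrable f (ν n) ↔ Integrable (fun t => w n t * (ρ t * f t)) V := by
    intro n f
    rw [integrable_withDensity_iff_integrable_smul' (hg n)
      (ae_of_all _ fun _ => ENNReal.ofReal_lt_top)]
    refine integrable_congr ?_
    filter_upwards [hgr n] with t ht
    rw [ht, Complex.real_smul]
    push_cast
    ring
  have hνv : ∀ n (f : ℝ → ℂ), ∫ t, f t ∂(ν n) = ∫ t, w n t * (ρ t * f t) ∂V := by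
    intro n f
    rw [integral_withDensity_eq_integral_toReal_smul (hg n)
      (ae_of_all _ fun _ => ENNReal.ofReal_lt_top)]
    refine integral_congr_ae ?_
    filter_upwards [hgr n] with t ht
    rw [ht, Complex.real_smul]
    push_cast
    ring
  have hexp : ∀ n (q : ℂ), -β < q.re → Integrable (fun x : ℝ => Complex.exp (-q * x)) (ν n) := by
    intro n q hq
    rw [hνi]
    have hs : -q.re < β := by linarith
    refine Integrable.mono' ((hρ _ hs).const_mul ((n + 1 : ℝ) ^ 2)) ?_ ?_
    · have := hw n
      exact Measurable.aestronglyMeasurable (by fun_prop)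
    · filter_upwards [hpos] with t ht
      have h1 := (hwb n t ht).2
      have h2 := h0 t ht
      rw [norm_mul, norm_mul, norm_cexp_neg_mul, Complex.norm_real, Complex.norm_real,
        Real.norm_of_nonneg (hw0 n t), Real.norm_of_nonneg h2]
      calc w n t * (ρ t * Real.exp (-q.re * t))
          ≤ ((n + 1) ^ 2 * t ^ 2) * (ρ t * Real.exp (-q.re * t)) := by gcongr
        _ = _ := by ring
  have hid : ∀ n, Integrable (fun x : ℝ => (x : ℂ)) (ν n) := by
    intro n
    rw [hνi]
    refine Integrable.mono' ((hρ _ hβ).const_mul (n + 1 : ℝ)) ?_ ?_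
    · have := hw n
      exact Measurable.aestronglyMeasurable (by fun_prop)
    · filter_upwards [hpos] with t ht
      have h1 := (hwb n t ht).1
      have h2 := h0 t ht
      rw [norm_mul, norm_mul, Complex.norm_real, Complex.norm_real, Complex.norm_real,
        Real.norm_of_nonneg (hw0 n t), Real.norm_of_nonneg h2, Real.norm_of_nonneg ht.le]
      calc w n t * (ρ t * t) ≤ ((n + 1) * t) * (ρ t * t) := by gcongr
        _ = (n + 1) * (t ^ 2 * 1 * ρ t) := by ring
        _ = _ := by rw [zero_mul, Real.exp_zero]
  have hfin : ∀ n, IsFiniteMeasure (ν n) := by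
    intro n
    have := hexp n 0 (by simpa using hβ)
    simpa [integrable_const_iff] using this
  have hprob : ∀ n, IsProbabilityMeasure (compoundPoisson (ν n)) := fun n =>
    isProbabilityMeasure_compoundPoisson _
  obtain ⟨Ω, _, P, X, hXm, hXl, hXi, hP⟩ :=
    exists_hasLaw_indepFun (fun _ : ℕ => ℝ) fun n => compoundPoisson (ν n)
  -- The mean of slice `n`: `d n - X n` is centered and has downward jumps, which yields the term `+
  -- q t` and the sign in `exp (-q t)`.
  set d : ℕ → ℝ := fun n => ∫ t, t ∂(ν n)
  have hfam : IsSummableFamily P (fun n ω => d n - X n ω) {p : ℝ | -β < p}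
      (fun n q => ∫ t in Set.Ioi (0 : ℝ), w n t * ((Complex.exp (-q * t) - 1 + q * t) * ρ t))
      (fun q => ∫ t in Set.Ioi (0 : ℝ), (Complex.exp (-q * t) - 1 + q * t) * ρ t) := by
    have hfac : ∀ n (q : ℂ) ω, Complex.exp (q * ((d n - X n ω : ℝ) : ℂ))
        = Complex.exp (q * d n) * Complex.exp (-q * X n ω) := by
      intro n q ω
      rw [← Complex.exp_add]
      push_cast
      ring_nf
    refine ⟨fun n => (hXm n).const_sub _, hXi.comp (fun n x => d n - x) fun n => by fun_prop,
      isOpen_lt continuous_const continuous_id, by simpa using hβ, ?_, ?_, ?_⟩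
    · intro n q hq
      simp_rw [hfac]
      refine Integrable.const_mul ?_ _
      have h1 := (integral_cexp_compoundPoisson (ν n) (hexp n q hq)).1
      rw [← (hXl n).map_eq] at h1
      exact h1.comp_measurable (hXm n)
    · intro n q hq
      simp_rw [hfac]
      obtain ⟨h1, h2⟩ := integral_cexp_compoundPoisson (ν n) (hexp n q hq)
      rw [integral_const_mul]
      have h3 := (hXl n).integral_comp (f := fun x : ℝ => Complex.exp (-q * x)) (by fun_prop)
      simp only [Function.comp_def] at h3
      rw [h3, h2, ← Complex.exp_add]
      congr 1
      have h4 : (d n : ℂ) = ∫ t : ℝ, (t : ℂ) ∂(ν n) := integral_complex_ofReal.symm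
      have h5 : Integrable (fun x : ℝ => Complex.exp (-q * x) - 1) (ν n) :=
        (hexp n q hq).sub (integrable_const _)
      rw [h4, ← integral_const_mul, ← integral_add ((hid n).const_mul q) h5, hνv]
      refine integral_congr_ae (ae_of_all _ fun t => ?_)
      simp only
      ring
    · intro q hq
      exact hasSum_integral_mul_of_hasSum_one hw (ae_of_all _ fun t n => hw0 n t)
        (ae_of_all _ hw1) (integrable_levyKhintchine hm h0 hβ hρ hq)
  obtain ⟨Z, hZm, -, hZ⟩ := hfam.exists_tendsto
  refine ⟨P.map Z, Measure.isProbabilityMeasure_map hZm.aemeasurable, fun q hq => ?_⟩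
  obtain ⟨h1, h2⟩ := hZ q hq
  refine ⟨(integrable_map_measure (by fun_prop) hZm.aemeasurable).2 h1, ?_⟩
  rw [integral_map hZm.aemeasurable (by fun_prop)]
  exact h2

/-! ### Mellin transforms; existence and uniqueness of Barnes beta laws -/

theorem ofReal_exp_cpow (r : ℝ) (q : ℂ) : ((Real.exp r : ℝ) : ℂ) ^ q = Complex.exp (q * r) := by
  rw [Complex.cpow_def_of_ne_zero (Complex.ofReal_ne_zero.2 (Real.exp_pos r).ne'),
    ← Complex.ofReal_log (Real.exp_pos r).le, Real.log_exp, mul_comm]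

theorem ofReal_cpow_eq_exp_log {x : ℝ} (hx : 0 < x) (q : ℂ) :
    (x : ℂ) ^ q = Complex.exp (q * Real.log x) := by
  rw [← ofReal_exp_cpow, Real.exp_log hx]

theorem measurable_ofReal_cpow (q : ℂ) : Measurable fun x : ℝ => (x : ℂ) ^ q := by
  fun_prop

/-- A probability measure on `(0, ∞)` is determined by its Mellin transform on the imaginary
axis. -/
theorem measure_eq_of_mellin {μ ν : Measure ℝ} [IsProbabilityMeasure μ] [IsProbabilityMeasure ν]
    (hμ : ∀ᵐ x ∂μ, 0 < x) (hν : ∀ᵐ x ∂ν, 0 < x)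
    (h : ∀ θ : ℝ, ∫ x : ℝ, (x : ℂ) ^ (θ * Complex.I) ∂μ = ∫ x : ℝ, (x : ℂ) ^ (θ * Complex.I) ∂ν) :
    μ = ν := by
  have hcf : ∀ (ρ : Measure ℝ), (∀ᵐ x ∂ρ, 0 < x) → ∀ θ : ℝ,
      charFun (ρ.map Real.log) θ = ∫ x : ℝ, (x : ℂ) ^ (θ * Complex.I) ∂ρ := by
    intro ρ hρ θ
    rw [charFun_apply_real, integral_map Real.measurable_log.aemeasurable (by fun_prop)]
    refine integral_congr_ae (hρ.mono fun x hx => ?_)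
    simp only
    rw [ofReal_cpow_eq_exp_log hx]
    ring_nf
  have hback : ∀ (ρ : Measure ℝ), (∀ᵐ x ∂ρ, 0 < x) → (ρ.map Real.log).map Real.exp = ρ := by
    intro ρ hρ
    rw [Measure.map_map Real.measurable_exp Real.measurable_log]
    conv_rhs => rw [← Measure.map_id (μ := ρ)]
    exact Measure.map_congr (hρ.mono fun x hx => Real.exp_log hx)
  have := Measure.isProbabilityMeasure_map (μ := μ) Real.measurable_log.aemeasurable
  have := Measure.isProbabilityMeasure_map (μ := ν) Real.measurable_log.aemeasurable
  have hlog : μ.map Real.log = ν.map Real.log :=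
    Measure.ext_of_charFun (funext fun θ => by rw [hcf μ hμ, hcf ν hν, h])
  rw [← hback μ hμ, ← hback ν hν, hlog]

variable {M N : ℕ} {a : Fin M → ℝ} {b : Fin N → ℝ}

theorem IsBarnesBeta.unique {b₀ : ℝ} (hb₀ : 0 < b₀) {μ ν : Measure ℝ}
    (hμ : IsBarnesBeta a b₀ b μ) (hν : IsBarnesBeta a b₀ b ν) : μ = ν := by
  have := hμ.isProbabilityMeasure
  have := hν.isProbabilityMeasure
  refine measure_eq_of_mellin hμ.pos hν.pos fun θ => ?_
  have hre : -b₀ < ((θ : ℂ) * Complex.I).re := by simpa using hb₀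
  rw [hμ.mellin _ hre, hν.mellin _ hre]

/-- Adding the integrable exponents at `q = ± b₀ / 2` cancels the compensators and leaves `(exp x +
exp (-x) - 2) ρ` with `x = b₀ t / 2`, which is at least `x ^ 2 / 2 * ρ`. -/
theorem integrableOn_sq_mul_levyDensity (hMN : M ≤ N + 1) (ha : ∀ i, 0 < a i) (hb : ∀ j, 0 < b j)
    {b₀ : ℝ} (hb₀ : 0 < b₀) :
    IntegrableOn (fun t => t ^ 2 * levyDensity a b₀ b t) (Set.Ioi 0) := by
  have h1 := (integrableOn_barnesExponent_and_barnesEta_eq hMN ha hb hb₀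
    (q := ((b₀ / 2 : ℝ) : ℂ)) (by rw [Complex.ofReal_re]; linarith)).1
  have h2 := (integrableOn_barnesExponent_and_barnesEta_eq hMN ha hb hb₀
    (q := -((b₀ / 2 : ℝ) : ℂ)) (by rw [Complex.neg_re, Complex.ofReal_re]; linarith)).1
  refine Integrable.mono' ((h1.add h2).norm.const_mul (8 / b₀ ^ 2))
    (Measurable.aestronglyMeasurable (by fun_prop)) ?_
  refine (ae_restrict_iff' measurableSet_Ioi).2 (ae_of_all _ fun t ht => ?_)
  have ht : 0 < t := ht
  have hρ := levyDensity_pos ha hb b₀ ht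
  set x : ℝ := b₀ / 2 * t with hx
  have hx0 : 0 ≤ x := by positivity
  have e : (barnesExponent a b₀ b ((b₀ / 2 : ℝ) : ℂ) + barnesExponent a b₀ b (-((b₀ / 2 : ℝ) : ℂ))) t
      = (((Real.exp (-x) + Real.exp x - 2) * levyDensity a b₀ b t : ℝ) : ℂ) := by
    simp only [Pi.add_apply, barnesExponent, hx]
    push_cast
    ring_nf
  rw [e, Complex.norm_real, Real.norm_of_nonneg (by positivity)]
  have h3 : x ^ 2 / 2 ≤ Real.exp (-x) + Real.exp x - 2 := by
    have := Real.quadratic_le_exp_of_nonneg hx0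
    have := Real.add_one_le_exp (-x)
    linarith
  rw [Real.norm_of_nonneg (mul_nonneg (by nlinarith [sq_nonneg x]) hρ.le)]
  calc t ^ 2 * levyDensity a b₀ b t = 8 / b₀ ^ 2 * (x ^ 2 / 2 * levyDensity a b₀ b t) := by
        rw [hx]; field_simp; norm_num
    _ ≤ _ := by gcongr

/-- The Barnes beta distribution exists whenever `M ≤ N + 1`. -/
theorem exists_isBarnesBeta (hMN : M ≤ N + 1) (ha : ∀ i, 0 < a i) (hb : ∀ j, 0 < b j)
    {b₀ : ℝ} (hb₀ : 0 < b₀) : ∃ μ : Measure ℝ, IsBarnesBeta a b₀ b μ := by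
  -- The weight `exp (s t)` merely replaces `b₀` by `b₀ - s > 0`.
  have hmom : ∀ s < b₀, IntegrableOn
      (fun t => t ^ 2 * Real.exp (s * t) * levyDensity a b₀ b t) (Set.Ioi 0) := by
    intro s hs
    refine (integrableOn_sq_mul_levyDensity hMN ha hb (sub_pos.2 hs)).congr_fun
      (fun t _ => ?_) measurableSet_Ioi
    simp only [levyDensity]
    rw [show -(b₀ - s) * t = s * t + -b₀ * t by ring, Real.exp_add]
    ring
  have hpos : ∀ t, 0 < t → 0 ≤ levyDensity a b₀ b t := fun t ht =>
    (levyDensity_pos ha hb b₀ ht).le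
  obtain ⟨μ, hμ, hμq⟩ := exists_levyKhintchine (measurable_levyDensity a b₀ b) hpos hb₀ hmom
  -- The discrepancy between the compensators `q t ρ` and `q c exp (-t) / t`; its integral `d` is a
  -- translation of the logarithm. Integrability follows by subtracting two integrable exponents at
  -- `q = 1`.
  set D : ℝ → ℝ := fun t => t * levyDensity a b₀ b t - levyCoeff a b * (Real.exp (-t) / t)
  set d : ℝ := ∫ t in Set.Ioi (0 : ℝ), D t
  have hJ := fun (q : ℂ) (hq : -b₀ < q.re) =>
    integrableOn_barnesExponent_and_barnesEta_eq hMN ha hb hb₀ hq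
  have hsplit : ∀ (q : ℂ) (t : ℝ), barnesExponent a b₀ b q t
      = (Complex.exp (-q * t) - 1 + q * t) * levyDensity a b₀ b t - q * (D t : ℂ) := by
    intro q t
    simp only [barnesExponent, D]
    push_cast
    ring
  have hD : IntegrableOn (fun t => (D t : ℂ)) (Set.Ioi 0) := by
    have h1 : -b₀ < (1 : ℂ).re := by rw [Complex.one_re]; linarith
    refine ((integrable_levyKhintchine (measurable_levyDensity a b₀ b) hpos hb₀ hmom h1).sub
      (hJ 1 h1).1).congr (ae_of_all _ fun t => ?_)
    simp only [Pi.sub_apply]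
    rw [hsplit]
    ring
  have heta : ∀ q : ℂ, -b₀ < q.re → barnesEta a b₀ b q = Complex.exp (-(q * d)) *
      Complex.exp (∫ t in Set.Ioi (0 : ℝ),
        (Complex.exp (-q * t) - 1 + q * t) * levyDensity a b₀ b t) := by
    intro q hq
    rw [(hJ q hq).2, ← Complex.exp_add]
    congr 1
    simp_rw [hsplit]
    rw [integral_sub (integrable_levyKhintchine (measurable_levyDensity a b₀ b) hpos hb₀ hmom hq)
      (hD.const_mul q), integral_const_mul, integral_complex_ofReal]
    ring
  have hmeas : Measurable fun x : ℝ => Real.exp (x - d) := by fun_prop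
  have hfac : ∀ (q : ℂ) (x : ℝ), ((Real.exp (x - d) : ℝ) : ℂ) ^ q
      = Complex.exp (-(q * d)) * Complex.exp (q * x) := by
    intro q x
    rw [ofReal_exp_cpow, ← Complex.exp_add]
    push_cast
    ring_nf
  refine ⟨μ.map fun x => Real.exp (x - d),
    Measure.isProbabilityMeasure_map hmeas.aemeasurable, ?_, fun q hq => ?_, fun q hq => ?_⟩
  · rw [ae_map_iff hmeas.aemeasurable measurableSet_Ioi]
    exact ae_of_all _ fun x => Real.exp_pos _
  · rw [integrable_map_measure (measurable_ofReal_cpow q).aestronglyMeasurable hmeas.aemeasurable]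
    simp only [Function.comp_def, hfac]
    exact (hμq q hq).1.const_mul _
  · rw [integral_map hmeas.aemeasurable (measurable_ofReal_cpow q).aestronglyMeasurable]
    simp only [hfac]
    rw [integral_const_mul, (hμq q hq).2, heta q hq]

theorem isBarnesBeta_barnesBeta (hMN : M ≤ N + 1) (ha : ∀ i, 0 < a i) (hb : ∀ j, 0 < b j)
    {b₀ : ℝ} (hb₀ : 0 < b₀) : IsBarnesBeta a b₀ b (barnesBeta a b₀ b) := by
  have h := exists_isBarnesBeta hMN ha hb hb₀
  rw [barnesBeta, dif_pos h]
  exact h.choose_spec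

/-! ### The ratio law -/

/-- The integrand of the logarithm of the Mellin transform of `barnesRatio a b₀ c₀ b`. -/
def ratioExponent (a : Fin M → ℝ) (b₀ c₀ : ℝ) (b : Fin N → ℝ) (q : ℂ) (t : ℝ) : ℂ :=
  (Complex.exp (-q * t) - 1) * levyDensity a b₀ b t
    + (Complex.exp (q * t) - 1) * levyDensity a c₀ b t

/-- `levyCoeff` does not involve `b₀` or `c₀`, so the compensators at `q` and `-q` cancel and only
terms proportional to the kernel remain. -/
theorem integrableOn_ratioExponent_and_barnesEta_mul (hMN : M ≤ N + 1) (ha : ∀ i, 0 < a i)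
    (hb : ∀ j, 0 < b j) {b₀ c₀ : ℝ} (hb₀ : 0 < b₀) (hc₀ : 0 < c₀) {q : ℂ} (hq : -b₀ < q.re)
    (hq' : q.re < c₀) :
    IntegrableOn (ratioExponent a b₀ c₀ b q) (Set.Ioi 0) ∧
      barnesEta a b₀ b q * barnesEta a c₀ b (-q)
        = Complex.exp (∫ t in Set.Ioi (0 : ℝ), ratioExponent a b₀ c₀ b q t) := by
  obtain ⟨h1, h2⟩ := integrableOn_barnesExponent_and_barnesEta_eq hMN ha hb hb₀ hq
  obtain ⟨h3, h4⟩ := integrableOn_barnesExponent_and_barnesEta_eq hMN ha hb hc₀ (q := -q)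
    (by rw [Complex.neg_re]; linarith)
  have e : ∀ t, ratioExponent a b₀ c₀ b q t
      = barnesExponent a b₀ b q t + barnesExponent a c₀ b (-q) t := by
    intro t
    simp only [ratioExponent, barnesExponent]
    ring_nf
  refine ⟨(h1.add h3).congr (ae_of_all _ fun t => (e t).symm), ?_⟩
  rw [h2, h4, ← Complex.exp_add]
  simp_rw [e]
  rw [integral_add h1 h3]

section Ratio

variable {b₀ c₀ : ℝ}

theorem isProbabilityMeasure_barnesRatio (hMN : M ≤ N + 1) (ha : ∀ i, 0 < a i)
    (hb : ∀ j, 0 < b j) (hb₀ : 0 < b₀) (hc₀ : 0 < c₀) :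
    IsProbabilityMeasure (barnesRatio a b₀ c₀ b) := by
  have := (isBarnesBeta_barnesBeta hMN ha hb hb₀).isProbabilityMeasure
  have := (isBarnesBeta_barnesBeta hMN ha hb hc₀).isProbabilityMeasure
  exact Measure.isProbabilityMeasure_map (by fun_prop)

theorem ae_pos_prod (hMN : M ≤ N + 1) (ha : ∀ i, 0 < a i)
    (hb : ∀ j, 0 < b j) (hb₀ : 0 < b₀) (hc₀ : 0 < c₀) :
    ∀ᵐ p ∂((barnesBeta a b₀ b).prod (barnesBeta a c₀ b)), 0 < p.1 ∧ 0 < p.2 := by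
  have h1 := isBarnesBeta_barnesBeta hMN ha hb hb₀
  have h2 := isBarnesBeta_barnesBeta hMN ha hb hc₀
  have := h1.isProbabilityMeasure
  have := h2.isProbabilityMeasure
  exact (Measure.quasiMeasurePreserving_fst.ae h1.pos).and
    (Measure.quasiMeasurePreserving_snd.ae h2.pos)

theorem ae_pos_barnesRatio (hMN : M ≤ N + 1) (ha : ∀ i, 0 < a i)
    (hb : ∀ j, 0 < b j) (hb₀ : 0 < b₀) (hc₀ : 0 < c₀) :
    ∀ᵐ x ∂(barnesRatio a b₀ c₀ b), 0 < x := by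
  rw [barnesRatio, ae_map_iff (by fun_prop) measurableSet_Ioi]
  exact (ae_pos_prod hMN ha hb hb₀ hc₀).mono fun p hp => mul_pos hp.1 (inv_pos.2 hp.2)

theorem ofReal_mul_inv_cpow {x y : ℝ} (hx : 0 < x) (hy : 0 < y) (q : ℂ) :
    ((x * y⁻¹ : ℝ) : ℂ) ^ q = (x : ℂ) ^ q * (y : ℂ) ^ (-q) := by
  rw [ofReal_cpow_eq_exp_log (mul_pos hx (inv_pos.2 hy)), ofReal_cpow_eq_exp_log hx,
    ofReal_cpow_eq_exp_log hy, ← Complex.exp_add, Real.log_mul hx.ne' (inv_pos.2 hy).ne',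
    Real.log_inv]
  push_cast
  ring_nf

theorem mellin_barnesRatio (hMN : M ≤ N + 1) (ha : ∀ i, 0 < a i)
    (hb : ∀ j, 0 < b j) (hb₀ : 0 < b₀) (hc₀ : 0 < c₀) {q : ℂ} (hq : -b₀ < q.re)
    (hq' : q.re < c₀) :
    Integrable (fun x : ℝ => (x : ℂ) ^ q) (barnesRatio a b₀ c₀ b) ∧
      ∫ x : ℝ, (x : ℂ) ^ q ∂(barnesRatio a b₀ c₀ b)
        = barnesEta a b₀ b q * barnesEta a c₀ b (-q) := by
  have h1 := isBarnesBeta_barnesBeta hMN ha hb hb₀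
  have h2 := isBarnesBeta_barnesBeta hMN ha hb hc₀
  have := h1.isProbabilityMeasure
  have := h2.isProbabilityMeasure
  have hm : Measurable fun p : ℝ × ℝ => p.1 * p.2⁻¹ := by fun_prop
  have hq2 : -c₀ < (-q).re := by rw [Complex.neg_re]; linarith
  have hae : ∀ᵐ p ∂((barnesBeta a b₀ b).prod (barnesBeta a c₀ b)),
      (p.1 : ℂ) ^ q * (p.2 : ℂ) ^ (-q) = ((p.1 * p.2⁻¹ : ℝ) : ℂ) ^ q :=
    (ae_pos_prod hMN ha hb hb₀ hc₀).mono fun p hp => (ofReal_mul_inv_cpow hp.1 hp.2 q).symm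
  constructor
  · rw [barnesRatio, integrable_map_measure (measurable_ofReal_cpow q).aestronglyMeasurable
      hm.aemeasurable]
    exact ((h1.integrable q hq).mul_prod (h2.integrable (-q) hq2)).congr hae
  · rw [barnesRatio, integral_map hm.aemeasurable (measurable_ofReal_cpow q).aestronglyMeasurable,
      ← integral_congr_ae hae,
      integral_prod_mul (fun x : ℝ => (x : ℂ) ^ q) (fun x : ℝ => (x : ℂ) ^ (-q)),
      h1.mellin q hq, h2.mellin (-q) hq2]

theorem mellin_barnesRatio_eq_exp (hMN : M ≤ N + 1) (ha : ∀ i, 0 < a i)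
    (hb : ∀ j, 0 < b j) (hb₀ : 0 < b₀) (hc₀ : 0 < c₀) {q : ℂ} (hq : -b₀ < q.re)
    (hq' : q.re < c₀) :
    ∫ x : ℝ, (x : ℂ) ^ q ∂(barnesRatio a b₀ c₀ b)
      = Complex.exp (∫ t in Set.Ioi (0 : ℝ), ratioExponent a b₀ c₀ b q t) := by
  rw [(mellin_barnesRatio hMN ha hb hb₀ hc₀ hq hq').2,
    (integrableOn_ratioExponent_and_barnesEta_mul hMN ha hb hb₀ hc₀ hq hq').2]

/-- The ratio law is determined by its Mellin transform on the imaginary axis. -/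
theorem eq_barnesRatio (hMN : M ≤ N + 1) (ha : ∀ i, 0 < a i)
    (hb : ∀ j, 0 < b j) (hb₀ : 0 < b₀) (hc₀ : 0 < c₀) {μ : Measure ℝ} [IsProbabilityMeasure μ]
    (hμ : ∀ᵐ x ∂μ, 0 < x)
    (h : ∀ θ : ℝ, ∫ x : ℝ, (x : ℂ) ^ (θ * Complex.I) ∂μ
      = Complex.exp (∫ t in Set.Ioi (0 : ℝ), ratioExponent a b₀ c₀ b (θ * Complex.I) t)) :
    μ = barnesRatio a b₀ c₀ b := by
  have := isProbabilityMeasure_barnesRatio hMN ha hb hb₀ hc₀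
  refine measure_eq_of_mellin hμ (ae_pos_barnesRatio hMN ha hb hb₀ hc₀) fun θ => ?_
  rw [h, mellin_barnesRatio_eq_exp hMN ha hb hb₀ hc₀ (by simpa using hb₀) (by simpa using hc₀)]

/-- Invariance of the ratio law under simultaneous scaling of all parameters. -/
theorem map_rpow_barnesRatio (hMN : M ≤ N + 1) (ha : ∀ i, 0 < a i)
    (hb : ∀ j, 0 < b j) (hb₀ : 0 < b₀) (hc₀ : 0 < c₀) {κ : ℝ} (hκ : 0 < κ) :
    (barnesRatio (fun i => κ * a i) (κ * b₀) (κ * c₀) (fun j => κ * b j)).map (fun x => x ^ κ)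
      = barnesRatio a b₀ c₀ b := by
  have ha' : ∀ i, 0 < κ * a i := fun i => mul_pos hκ (ha i)
  have hb' : ∀ j, 0 < κ * b j := fun j => mul_pos hκ (hb j)
  have hb₀' := mul_pos hκ hb₀
  have hc₀' := mul_pos hκ hc₀
  have := isProbabilityMeasure_barnesRatio hMN ha' hb' hb₀' hc₀'
  have hpos := ae_pos_barnesRatio hMN ha' hb' hb₀' hc₀'
  have hm : Measurable fun x : ℝ => x ^ κ := by fun_prop
  have := Measure.isProbabilityMeasure_map
    (μ := barnesRatio (fun i => κ * a i) (κ * b₀) (κ * c₀) (fun j => κ * b j)) hm.aemeasurable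
  refine eq_barnesRatio hMN ha hb hb₀ hc₀ ?_ fun θ => ?_
  · rw [ae_map_iff hm.aemeasurable measurableSet_Ioi]
    exact hpos.mono fun x hx => Real.rpow_pos_of_pos hx _
  · have hre : (((κ * θ : ℝ) : ℂ) * Complex.I).re = 0 := by simp
    rw [integral_map hm.aemeasurable (measurable_ofReal_cpow _).aestronglyMeasurable]
    have e1 : ∀ᵐ x ∂(barnesRatio (fun i => κ * a i) (κ * b₀) (κ * c₀) (fun j => κ * b j)),
        (((x ^ κ : ℝ)) : ℂ) ^ ((θ : ℂ) * Complex.I) = (x : ℂ) ^ (((κ * θ : ℝ) : ℂ) * Complex.I) := by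
      filter_upwards [hpos] with x hx
      rw [ofReal_cpow_eq_exp_log (Real.rpow_pos_of_pos hx _), ofReal_cpow_eq_exp_log hx,
        Real.log_rpow hx]
      push_cast
      ring_nf
    rw [integral_congr_ae e1, mellin_barnesRatio_eq_exp hMN ha' hb' hb₀' hc₀'
      (by rw [hre]; linarith) (by rw [hre]; linarith)]
    congr 1
    -- The kernel sees parameters only through their products with `t`, and `1 / t` accounts for the
    -- factor `κ`, which the change of variables absorbs.
    have e2 : ∀ t, ratioExponent (fun i => κ * a i) (κ * b₀) (κ * c₀) (fun j => κ * b j)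
        (((κ * θ : ℝ) : ℂ) * Complex.I) t
        = κ * ratioExponent a b₀ c₀ b ((θ : ℂ) * Complex.I) (κ * t) := by
      intro t
      have hd : ∀ x : ℝ, levyDensity (fun i => κ * a i) (κ * x) (fun j => κ * b j) t
          = κ * levyDensity a x b (κ * t) := by
        intro x
        have e3 : ∀ y : ℝ, -(κ * y) * t = -y * (κ * t) := fun y => by ring
        simp only [levyDensity, barnesKernel, e3]
        rw [div_eq_mul_inv, div_eq_mul_inv, mul_inv]
        field_simp
      simp only [ratioExponent, hd]
      push_cast
      ring_nf
    simp_rw [e2]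
    rw [integral_const_mul, integral_comp_mul_left_Ioi _ _ hκ, mul_zero, Complex.real_smul,
      ← mul_assoc, ← Complex.ofReal_mul, mul_inv_cancel₀ hκ.ne', Complex.ofReal_one, one_mul]

end Ratio

/-! ### Independence of blocks -/

section Curry

variable {Ω ι κ : Type*} [MeasurableSpace Ω] {P : Measure Ω}

/-- Grouping independent random variables into blocks. -/
theorem ProbabilityTheory.iIndepFun.curry {E : Type*} [MeasurableSpace E]
    {X : ι → κ → Ω → E} (mX : ∀ i j, Measurable (X i j))
    (h : iIndepFun (fun (p : (_ : ι) × κ) ω => X p.1 p.2 ω) P) :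
    iIndepFun (fun i ω => (X i · ω)) P := by
  have := h.isProbabilityMeasure
  have hp : ∀ i j, IsProbabilityMeasure (P.map (X i j)) :=
    fun i j => Measure.isProbabilityMeasure_map (mX i j).aemeasurable
  have hrow : ∀ i, iIndepFun (X i) P := fun i =>
    h.precomp (g := fun j : κ => (⟨i, j⟩ : (_ : ι) × κ)) fun j j' hj => by simpa using hj
  have hcomp : (MeasurableEquiv.piCurry fun (_ : ι) (_ : κ) => E) ∘
      (fun ω p => X p.1 p.2 ω) = fun ω i j => X i j ω := by
    ext; simp [Sigma.curry]
  rw [iIndepFun_iff_map_fun_eq_infinitePi_map (by fun_prop), ← hcomp,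
    ← Measure.map_map (by fun_prop) (by fun_prop),
    (iIndepFun_iff_map_fun_eq_infinitePi_map (by fun_prop)).1 h,
    Measure.infinitePi_map_piCurry (fun i j => P.map (X i j))]
  congr 1
  funext i
  exact ((iIndepFun_iff_map_fun_eq_infinitePi_map (by fun_prop)).1 (hrow i)).symm

end Curry

/-! ### Factorization from a decomposition of the kernel -/

section Factorization

variable {M M' N : ℕ} {a : Fin M → ℝ} {a' : Fin M' → ℝ} {b : Fin N → ℝ} {b₀ c₀ : ℝ}
  {ι : Type*} [Countable ι] {o : ι → ℝ}

/-- The quotients `exp (-o n * t) * K' / K` are a partition of unity, and the same weight carries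
both Lévy densities to those with `b₀`, `c₀` shifted by `o n`. Only the total exponent has to be
integrable. -/
theorem hasSum_integral_ratioExponent (hMN : M ≤ N + 1) (ha : ∀ i, 0 < a i)
    (ha' : ∀ i, 0 < a' i) (hb : ∀ j, 0 < b j) (hb₀ : 0 < b₀) (hc₀ : 0 < c₀)
    (hK : ∀ t, 0 < t →
      HasSum (fun n => Real.exp (-o n * t) * barnesKernel a' b t) (barnesKernel a b t))
    {q : ℂ} (hq : -b₀ < q.re) (hq' : q.re < c₀) :
    HasSum (fun n => ∫ t in Set.Ioi (0 : ℝ), ratioExponent a' (b₀ + o n) (c₀ + o n) b q t)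
      (∫ t in Set.Ioi (0 : ℝ), ratioExponent a b₀ c₀ b q t) := by
  set w : ι → ℝ → ℝ := fun n t => Real.exp (-o n * t) * barnesKernel a' b t / barnesKernel a b t
  have hpos : ∀ᵐ t ∂(volume.restrict (Set.Ioi (0 : ℝ))), 0 < t := ae_restrict_mem measurableSet_Ioi
  have h := hasSum_integral_mul_of_hasSum_one (μ := volume.restrict (Set.Ioi (0 : ℝ))) (w := w)
    (fun n => by simp only [w]; fun_prop)
    (hpos.mono fun t ht n => div_nonneg (mul_nonneg (Real.exp_pos _).le
      (barnesKernel_pos ha' hb ht).le) (barnesKernel_pos ha hb ht).le)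
    (hpos.mono fun t ht => by
      have h1 := (hK t ht).div_const (barnesKernel a b t)
      rwa [div_self (barnesKernel_pos ha hb ht).ne'] at h1)
    (integrableOn_ratioExponent_and_barnesEta_mul hMN ha hb hb₀ hc₀ hq hq').1
  refine h.congr_fun fun n => integral_congr_ae (hpos.mono fun t ht => ?_)
  have hk := (barnesKernel_pos ha hb ht).ne'
  have hd : ∀ x : ℝ, levyDensity a' (x + o n) b t = w n t * levyDensity a x b t := by
    intro x
    simp only [levyDensity, w]
    rw [show -(x + o n) * t = -x * t + -o n * t by ring, Real.exp_add]
    field_simp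
  simp only [ratioExponent, hd]
  push_cast
  ring

theorem hasProd_barnesEta_mul (hMN : M ≤ N + 1) (hMN' : M' ≤ N + 1) (ha : ∀ i, 0 < a i)
    (ha' : ∀ i, 0 < a' i) (hb : ∀ j, 0 < b j) (hb₀ : 0 < b₀) (hc₀ : 0 < c₀) (ho : ∀ n, 0 ≤ o n)
    (hK : ∀ t, 0 < t →
      HasSum (fun n => Real.exp (-o n * t) * barnesKernel a' b t) (barnesKernel a b t))
    {q : ℂ} (hq : -b₀ < q.re) (hq' : q.re < c₀) :
    HasProd (fun n => barnesEta a' (b₀ + o n) b q * barnesEta a' (c₀ + o n) b (-q))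
      (∫ x : ℝ, (x : ℂ) ^ q ∂(barnesRatio a b₀ c₀ b)) := by
  rw [mellin_barnesRatio_eq_exp hMN ha hb hb₀ hc₀ hq hq']
  refine (hasSum_integral_ratioExponent hMN ha ha' hb hb₀ hc₀ hK hq hq').cexp.congr_fun fun n => ?_
  have := ho n
  exact (integrableOn_ratioExponent_and_barnesEta_mul hMN' ha' hb (by linarith) (by linarith)
    (by linarith) (by linarith)).2

/-- The ratio law is the law of the infinite product of independent ratios whose Lévy densities
sum up to its own. -/
theorem exists_isInfiniteProduct_barnesRatio [Infinite ι] (hMN : M ≤ N + 1) (hMN' : M' ≤ N + 1)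
    (ha : ∀ i, 0 < a i)
    (ha' : ∀ i, 0 < a' i) (hb : ∀ j, 0 < b j) (hb₀ : 0 < b₀) (hc₀ : 0 < c₀) (ho : ∀ n, 0 ≤ o n)
    (hK : ∀ t, 0 < t →
      HasSum (fun n => Real.exp (-o n * t) * barnesKernel a' b t) (barnesKernel a b t))
    {Ω : Type*} [MeasurableSpace Ω] (P : Measure Ω) [IsProbabilityMeasure P] (X Y : ι → Ω → ℝ)
    (hind : iIndepFun (Sum.elim X Y) P)
    (hX : ∀ n, HasLaw (X n) (barnesBeta a' (b₀ + o n) b) P)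
    (hY : ∀ n, HasLaw (Y n) (barnesBeta a' (c₀ + o n) b) P) :
    ∃ Z : Ω → ℝ, IsInfiniteProduct P (fun n ω => X n ω * (Y n ω)⁻¹) Z ∧
      HasLaw Z (barnesRatio a b₀ c₀ b) P := by
  have hb' : ∀ n, 0 < b₀ + o n := fun n => by linarith [ho n]
  have hc' : ∀ n, 0 < c₀ + o n := fun n => by linarith [ho n]
  -- Measurable versions of all variables, indexed by pairs so that each `X n`, `Y n` forms one
  -- block; the blocks, hence the log-ratios, are independent.
  set V : ι → Bool → Ω → ℝ := fun n j => if j then (hX n).aemeasurable.mk else (hY n).aemeasurable.mk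
  have hV : ∀ n j, Measurable (V n j) := by
    intro n j
    cases j
    · exact (hY n).aemeasurable.measurable_mk
    · exact (hX n).aemeasurable.measurable_mk
  have hXV : ∀ n, X n =ᵐ[P] V n true := fun n => (hX n).aemeasurable.ae_eq_mk
  have hYV : ∀ n, Y n =ᵐ[P] V n false := fun n => (hY n).aemeasurable.ae_eq_mk
  have hVind : iIndepFun (fun (p : (_ : ι) × Bool) ω => V p.1 p.2 ω) P := by
    have hg : Function.Injective fun p : (_ : ι) × Bool =>
        (if p.2 then Sum.inl p.1 else Sum.inr p.1 : ι ⊕ ι) := by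
      rintro ⟨n, _ | _⟩ ⟨k, _ | _⟩ h <;> simp_all
    refine (hind.precomp hg).congr fun p => ?_
    obtain ⟨n, _ | _⟩ := p
    · exact hYV n
    · exact hXV n
  have hW : iIndepFun (fun n ω => Real.log (V n true ω * (V n false ω)⁻¹)) P :=
    (iIndepFun.curry hV hVind).comp (fun _ v => Real.log (v true * (v false)⁻¹))
      fun _ => by fun_prop
  have hlaw : ∀ n, P.map (fun ω => V n true ω * (V n false ω)⁻¹)
      = barnesRatio a' (b₀ + o n) (c₀ + o n) b := by
    intro n
    have hne : (⟨n, true⟩ : (_ : ι) × Bool) ≠ ⟨n, false⟩ := by simp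
    have h1 := (hVind.indepFun hne).map_prod_eq_prod_map_map (hV n true).aemeasurable
      (hV n false).aemeasurable
    rw [← Measure.map_congr (hXV n), ← Measure.map_congr (hYV n), (hX n).map_eq, (hY n).map_eq]
      at h1
    rw [barnesRatio, ← h1, Measure.map_map (by fun_prop) (by fun_prop)]
    rfl
  have hVm : ∀ n, Measurable fun ω => V n true ω * (V n false ω)⁻¹ := fun n =>
    (hV n true).mul (hV n false).inv
  have hVpos : ∀ n, ∀ᵐ ω ∂P, 0 < V n true ω * (V n false ω)⁻¹ := by
    intro n
    have h1 := ae_pos_barnesRatio hMN' ha' hb (hb' n) (hc' n)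
    rw [← hlaw n] at h1
    exact ae_of_ae_map (hVm n).aemeasurable h1
  have hfam : IsSummableFamily P (fun n ω => Real.log (V n true ω * (V n false ω)⁻¹))
      (Set.Ioo (-b₀) c₀)
      (fun n q => ∫ t in Set.Ioi (0 : ℝ), ratioExponent a' (b₀ + o n) (c₀ + o n) b q t)
      (fun q => ∫ t in Set.Ioi (0 : ℝ), ratioExponent a b₀ c₀ b q t) := by
    have hcpow : ∀ n (q : ℂ), ∀ᵐ ω ∂P, ((V n true ω * (V n false ω)⁻¹ : ℝ) : ℂ) ^ q
        = Complex.exp (q * Real.log (V n true ω * (V n false ω)⁻¹)) := fun n q =>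
      (hVpos n).mono fun ω hω => ofReal_cpow_eq_exp_log hω q
    refine ⟨fun n => (hVm n).log, hW, isOpen_Ioo, ⟨by linarith, hc₀⟩, fun n q hq => ?_,
      fun n q hq => ?_, fun q hq => hasSum_integral_ratioExponent hMN ha ha' hb hb₀ hc₀ hK hq.1 hq.2⟩
    · have h1 := (mellin_barnesRatio hMN' ha' hb (hb' n) (hc' n) (q := q)
        (by linarith [hq.1, ho n]) (by linarith [hq.2, ho n])).1
      rw [← hlaw n, integrable_map_measure (measurable_ofReal_cpow q).aestronglyMeasurable
        (hVm n).aemeasurable] at h1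
      exact h1.congr (hcpow n q)
    · have h1 := mellin_barnesRatio_eq_exp hMN' ha' hb (hb' n) (hc' n) (q := q)
        (by linarith [hq.1, ho n]) (by linarith [hq.2, ho n])
      rw [← hlaw n, integral_map (hVm n).aemeasurable
        (measurable_ofReal_cpow q).aestronglyMeasurable] at h1
      rw [← h1]
      exact integral_congr_ae ((hcpow n q).mono fun ω hω => hω.symm)
  obtain ⟨Z, hZm, hZ, hZq⟩ := hfam.exists_tendsto
  have hae : ∀ᵐ ω ∂P, ∀ n, X n ω * (Y n ω)⁻¹
      = Real.exp (Real.log (V n true ω * (V n false ω)⁻¹)) := by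
    refine ae_all_iff.2 fun n => ?_
    filter_upwards [hXV n, hYV n, hVpos n] with ω h1 h2 h3
    rw [Real.exp_log h3, h1, h2]
  have hexpm : Measurable fun ω => Real.exp (Z ω) := hZm.exp
  refine ⟨fun ω => Real.exp (Z ω), fun e => ?_, ⟨hexpm.aemeasurable, ?_⟩⟩
  · filter_upwards [hZ e, hae] with ω h1 h2
    refine ((Real.continuous_exp.tendsto _).comp h1).congr fun n => ?_
    simp only [Function.comp_apply, h2, Real.exp_sum]
  · have := Measure.isProbabilityMeasure_map (μ := P) hexpm.aemeasurable
    refine eq_barnesRatio hMN ha hb hb₀ hc₀ ?_ fun θ => ?_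
    · rw [ae_map_iff hexpm.aemeasurable measurableSet_Ioi]
      exact ae_of_all _ fun ω => Real.exp_pos _
    · rw [integral_map hexpm.aemeasurable (measurable_ofReal_cpow _).aestronglyMeasurable]
      simp only [ofReal_exp_cpow]
      exact (hZq _ (by simpa using ⟨hb₀, hc₀⟩)).2

end Factorization

/-! ### Geometric expansions of the kernel -/

section Kernels

variable {m : ℕ} {a : Fin (m + 1) → ℝ} {N : ℕ}

theorem hasSum_exp_mul_barnesKernel_removeNth (ha : ∀ i, 0 < a i) (b : Fin N → ℝ)
    (i : Fin (m + 1)) {t : ℝ} (ht : 0 < t) :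
    HasSum (fun k : ℕ => Real.exp (-(k * a i) * t) * barnesKernel (i.removeNth a) b t)
      (barnesKernel a b t) := by
  have h1 : Real.exp (-a i * t) < 1 := by linarith [one_sub_exp_pos (ha i) ht]
  have h := (hasSum_geometric_of_lt_one (Real.exp_pos _).le h1).mul_right
    (barnesKernel (i.removeNth a) b t)
  have e : barnesKernel a b t
      = (1 - Real.exp (-a i * t))⁻¹ * barnesKernel (i.removeNth a) b t := by
    simp only [barnesKernel]
    rw [Fin.prod_univ_succAbove _ i]
    simp only [Fin.removeNth]
    ring
  rw [e]
  refine h.congr_fun fun k => ?_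
  rw [← Real.exp_nat_mul]
  ring_nf

theorem hasSum_prod_pow {M : ℕ} {r : Fin M → ℝ} (h0 : ∀ i, 0 ≤ r i) (h1 : ∀ i, r i < 1) :
    HasSum (fun n : Fin M → ℕ => ∏ i, r i ^ n i) (∏ i, (1 - r i)⁻¹) := by
  induction M with
  | zero => simp
  | succ M ih =>
    have g0 := hasSum_geometric_of_lt_one (h0 0) (h1 0)
    have g1 := ih (r := fun i => r i.succ) (fun i => h0 _) fun i => h1 _
    have p0 : 0 ≤ fun k : ℕ => r 0 ^ k := fun k => pow_nonneg (h0 0) k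
    have p1 : 0 ≤ fun n : Fin M → ℕ => ∏ i, r i.succ ^ n i := by
      intro n
      show (0 : ℝ) ≤ ∏ i, r i.succ ^ n i
      exact Finset.prod_nonneg fun i _ => pow_nonneg (h0 i.succ) (n i)
    have hs := HasSum.mul g0 g1 (Summable.mul_of_nonneg (f := fun k : ℕ => r 0 ^ k)
      (g := fun n : Fin M → ℕ => ∏ i, r i.succ ^ n i) g0.summable g1.summable p0 p1)
    rw [Fin.prod_univ_succ, ← (Fin.consEquiv fun _ : Fin (M + 1) => ℕ).hasSum_iff]
    refine hs.congr_fun fun p => ?_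
    simp [Fin.consEquiv, Fin.prod_univ_succ]

theorem hasSum_exp_mul_barnesKernel_latticePoint {M : ℕ} {a : Fin M → ℝ} (ha : ∀ i, 0 < a i)
    (b : Fin N → ℝ) {t : ℝ} (ht : 0 < t) :
    HasSum (fun n : Fin M → ℕ => Real.exp (-latticePoint a n * t) *
      barnesKernel (![] : Fin 0 → ℝ) b t) (barnesKernel a b t) := by
  have h := (hasSum_prod_pow (r := fun i => Real.exp (-a i * t)) (fun i => (Real.exp_pos _).le)
    fun i => by linarith [one_sub_exp_pos (ha i) ht]).mul_left (∏ j, (1 - Real.exp (-b j * t)))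
  refine h.congr_fun fun n => ?_
  simp only [barnesKernel, latticePoint, Finset.univ_eq_empty, Finset.prod_empty, mul_one]
  rw [mul_comm, ← Finset.sum_neg_distrib, Finset.sum_mul, Real.exp_sum]
  congr 1
  refine Finset.prod_congr rfl fun i _ => ?_
  rw [← Real.exp_nat_mul]
  ring_nf

end Kernels

/-! ### Explicit factors of type `(0, N)` -/

section TypeZero

/-- The complex Frullani integral. -/
theorem cexp_integral_frullani {x : ℝ} (hx : 0 < x) {q : ℂ} (hq : -x < q.re) :
    Complex.exp (∫ t in Set.Ioi (0 : ℝ),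
      (Complex.exp (-q * t) - 1) * (Real.exp (-x * t) / t : ℝ)) = x / (q + x) := by
  -- Deform `q` to `s * q` with `s ∈ [0, 1]`: differentiation in `s` removes the denominator `t` and
  -- leaves an elementary integral.
  set F : ℝ → ℝ → ℂ := fun s t => (Complex.exp (-(s * q) * t) - 1) * (Real.exp (-x * t) / t : ℝ)
  set F' : ℝ → ℝ → ℂ := fun s t => -q * Complex.exp (-(s * q + x) * t)
  have hpos : ∀ s ∈ Set.Icc (0 : ℝ) 1, 0 < s * q.re + x := by
    intro s hs
    rcases le_total 0 q.re with h | h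
    · nlinarith [hs.1, mul_nonneg hs.1 h]
    · nlinarith [hs.2]
  have hFm : ∀ s, Measurable (F s) := fun s => by simp only [F]; fun_prop
  have hbound : ∀ s ∈ Set.Icc (0 : ℝ) 1, ∀ t, 0 < t →
      ‖F s t‖ ≤ ‖q‖ * (Real.exp (-x * t) + Real.exp (-(q.re + x) * t)) := by
    intro s hs t ht
    have h1 := norm_cexp_sub_one_le (-(s * q) * t)
    have e1 : (-(s * q) * t : ℂ).re = -(s * q.re) * t := by simp
    have e2 : ‖(-(s * q) * t : ℂ)‖ = s * ‖q‖ * t := by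
      rw [norm_mul, norm_neg, norm_mul, Complex.norm_real, Complex.norm_real,
        Real.norm_of_nonneg hs.1, Real.norm_of_nonneg ht.le]
    rw [e1, e2] at h1
    have h2 : Real.exp (max 0 (-(s * q.re) * t)) ≤ 1 + Real.exp (-q.re * t) := by
      rcases le_total 0 q.re with h | h
      · rw [max_eq_left (by nlinarith [mul_nonneg (mul_nonneg hs.1 h) ht.le]), Real.exp_zero]
        linarith [Real.exp_pos (-q.re * t)]
      · have : max 0 (-(s * q.re) * t) ≤ -q.re * t := by
          refine max_le (by nlinarith) ?_
          have : s * (-q.re) ≤ -q.re := by nlinarith [hs.2]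
          nlinarith
        linarith [Real.exp_le_exp.2 this]
    simp only [F]
    rw [norm_mul, Complex.norm_real, Real.norm_of_nonneg (by positivity)]
    calc _ ≤ (1 * ‖q‖ * t * (1 + Real.exp (-q.re * t))) * (Real.exp (-x * t) / t) := by
          gcongr
          refine h1.trans ?_
          gcongr
          exact hs.2
      _ = _ := by
        rw [show -(q.re + x) * t = -q.re * t + -x * t by ring, Real.exp_add]
        field_simp
  have hFi : ∀ s ∈ Set.Icc (0 : ℝ) 1, IntegrableOn (F s) (Set.Ioi 0) := by
    intro s hs
    refine Integrable.mono' (((exp_neg_integrableOn_Ioi 0 hx).add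
      (exp_neg_integrableOn_Ioi 0 (show 0 < q.re + x by linarith))).const_mul ‖q‖)
      (hFm s).aestronglyMeasurable ?_
    exact (ae_restrict_mem measurableSet_Ioi).mono fun t ht => hbound s hs t ht
  have hval : ∀ s ∈ Set.Icc (0 : ℝ) 1,
      ∫ t in Set.Ioi (0 : ℝ), F' s t = -q / (s * q + x) := by
    intro s hs
    have hre : (-(s * q + x) : ℂ).re < 0 := by
      have := hpos s hs
      simp only [Complex.neg_re, Complex.add_re, Complex.re_ofReal_mul, Complex.ofReal_re]
      linarith
    simp only [F']
    rw [integral_const_mul, integral_exp_mul_complex_Ioi hre, Complex.ofReal_zero, mul_zero,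
      Complex.exp_zero, neg_div_neg_eq]
    ring
  have hderiv : ∀ s ∈ Set.Icc (0 : ℝ) 1,
      HasDerivAt (fun s => ∫ t in Set.Ioi (0 : ℝ), F s t) (-q / (s * q + x)) s := by
    intro s hs
    rw [← hval s hs]
    -- Half the decay rate at `s`: it still bounds the rates for nearby `u` from below, giving a
    -- uniform dominating function.
    set ε := (s * q.re + x) / 2
    have hε : 0 < ε := half_pos (hpos s hs)
    have hU : {u : ℝ | ε < u * q.re + x} ∈ 𝓝 s := by
      refine (isOpen_lt (by fun_prop) (by fun_prop)).mem_nhds ?_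
      have := hpos s hs
      simp only [Set.mem_ofPred_eq, ε]
      linarith
    refine (hasDerivAt_integral_of_dominated_loc_of_deriv_le (F := F) (F' := F')
      (bound := fun t => ‖q‖ * Real.exp (-ε * t)) hU
      (Eventually.of_forall fun u => (hFm u).aestronglyMeasurable) (hFi s hs)
      (Measurable.aestronglyMeasurable (by simp only [F']; fun_prop))
      ?_ ((exp_neg_integrableOn_Ioi 0 hε).const_mul ‖q‖) ?_).2
    · filter_upwards [ae_restrict_mem measurableSet_Ioi] with t ht u hu
      have ht : 0 < t := ht
      have hu : ε < u * q.re + x := hu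
      simp only [F']
      rw [norm_mul, norm_neg, norm_cexp_neg_mul]
      simp only [Complex.add_re, Complex.re_ofReal_mul, Complex.ofReal_re]
      gcongr
    · filter_upwards [ae_restrict_mem measurableSet_Ioi] with t ht u _
      have ht0 : (t : ℂ) ≠ 0 := Complex.ofReal_ne_zero.2 (ne_of_gt ht)
      have h1 : HasDerivAt (fun u : ℝ => Complex.exp (-(u * q) * t) - 1)
          (Complex.exp (-(u * q) * t) * (-(1 * q) * t)) u :=
        (((((hasDerivAt_id u).ofReal_comp.mul_const q).neg).mul_const (t : ℂ)).cexp).sub_const 1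
      have h2 := h1.mul_const ((Real.exp (-x * t) / t : ℝ) : ℂ)
      refine h2.congr_deriv ?_
      simp only [F']
      rw [show (-(u * q + x) * t : ℂ) = -(u * q) * t + -x * t by ring, Complex.exp_add]
      push_cast
      field_simp
  -- Constancy of this product avoids choosing a branch of the complex logarithm; its value at `s =
  -- 0` is `x`.
  set G : ℝ → ℂ := fun s => (s * q + x) * Complex.exp (∫ t in Set.Ioi (0 : ℝ), F s t)
  have hG : ∀ s ∈ Set.Icc (0 : ℝ) 1, HasDerivAt G 0 s := by
    intro s hs
    have h1 : HasDerivAt (fun s : ℝ => (s * q + x : ℂ)) (1 * q) s :=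
      ((hasDerivAt_id s).ofReal_comp.mul_const q).add_const _
    refine (h1.mul (hderiv s hs).cexp).congr_deriv ?_
    have hne : (s * q + x : ℂ) ≠ 0 := by
      intro h0
      have h2 := congrArg Complex.re h0
      simp only [Complex.add_re, Complex.re_ofReal_mul, Complex.ofReal_re, Complex.zero_re] at h2
      linarith [hpos s hs]
    generalize (s * q + x : ℂ) = z at hne ⊢
    field_simp
    ring
  have hconst := constant_of_has_deriv_right_zero (f := G) (a := 0) (b := 1)
    (fun s hs => (hG s hs).continuousAt.continuousWithinAt)
    (fun s hs => (hG s ⟨hs.1, hs.2.le⟩).hasDerivWithinAt) 1 (by simp)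
  have hne : (q + x : ℂ) ≠ 0 := by
    intro h0
    have h2 := congrArg Complex.re h0
    simp only [Complex.add_re, Complex.ofReal_re, Complex.zero_re] at h2
    linarith
  rw [eq_div_iff hne, mul_comm]
  simpa [G, F] using hconst

/-- This is `η` of type `(0, 0)`, whose alternating sum has the empty subset only and whose exponent
is Frullani's integrand. -/
theorem cexp_logMultipleGamma_sub {x : ℝ} (hx : 0 < x) {q : ℂ} (hq : -x < q.re) :
    Complex.exp (logMultipleGamma (![] : Fin 0 → ℝ) (q + x)
      - logMultipleGamma (![] : Fin 0 → ℝ) (0 + x)) = x / (q + x) := by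
  have h2 := (integrableOn_barnesExponent_and_barnesEta_eq (a := (![] : Fin 0 → ℝ))
    (b := (![] : Fin 0 → ℝ)) (by simp) (fun i => i.elim0) (fun i => i.elim0) hx hq).2
  have e : barnesExponent (![] : Fin 0 → ℝ) x (![] : Fin 0 → ℝ) q
      = fun t : ℝ => (Complex.exp (-q * t) - 1) * (Real.exp (-x * t) / t : ℝ) := by
    ext t
    simp [barnesExponent, levyDensity, levyCoeff, barnesKernel]
  rw [e] at h2
  rw [cexp_integral_frullani hx hq] at h2
  have hd : (default : Finset (Fin 0)) = ∅ := Subsingleton.elim _ _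
  rw [← h2, barnesEta]
  simp [barnesS, hd]

theorem barnesEta_type_zero {N : ℕ} {b : Fin N → ℝ} (hb : ∀ j, 0 < b j) {b₀ : ℝ}
    (hb₀ : 0 < b₀) {q : ℂ} (hq : -b₀ < q.re) :
    barnesEta (![] : Fin 0 → ℝ) b₀ b q = ∏ s : Finset (Fin N),
      ((b₀ + ∑ j ∈ s, (b j : ℂ)) / (q + b₀ + ∑ j ∈ s, (b j : ℂ))) ^ ((-1 : ℤ) ^ s.card) := by
  rw [barnesEta, barnesS, barnesS, ← Finset.sum_sub_distrib, Complex.exp_sum]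
  refine Finset.prod_congr rfl fun s _ => ?_
  have hs : 0 ≤ ∑ j ∈ s, b j := Finset.sum_nonneg fun j _ => (hb j).le
  have h := cexp_logMultipleGamma_sub (x := b₀ + ∑ j ∈ s, b j) (by linarith) (q := q)
    (by linarith)
  push_cast at h
  simp only [← add_assoc] at h
  rw [← h, ← Complex.exp_int_mul]
  push_cast
  ring_nf

/-- The argument and `b₀` enter only through their sum, and the normalizing terms cancel in the
quotient. -/
theorem barnesEta_add_div {M N : ℕ} (a : Fin M → ℝ) (b₀ : ℝ) (b : Fin N → ℝ) (q : ℂ) (x : ℝ) :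
    barnesEta a b₀ b (q + x) / barnesEta a b₀ b x = barnesEta a (b₀ + x) b q := by
  unfold barnesEta
  rw [← Complex.exp_sub]
  have e : ∀ p : ℂ, barnesS (logMultipleGamma a) (p + x) b₀ b
      = barnesS (logMultipleGamma a) p (b₀ + x) b := by
    intro p
    unfold barnesS
    refine Finset.sum_congr rfl fun s _ => ?_
    push_cast
    ring_nf
  have h0 := e 0
  rw [zero_add] at h0
  rw [e, h0]
  ring_nf

end TypeZero

end

/-! ### The theorem on ratios of Barnes beta laws -/

theorem theorem3p3 {m : ℕ} (a : Fin (m + 1) → ℝ) (ha : ∀ i, 0 < a i)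
    (b : Fin m → ℝ) (hb : ∀ j, 0 < b j) (b₀ c₀ : ℝ) (hb₀ : 0 < b₀) (hc₀ : 0 < c₀) :
    -- the Barnes beta laws of types `(M, M - 1)`, `(M - 1, M - 1)` and `(0, M - 1)` with `M = m + 1`
    -- exist and are determined by their Mellin transforms
    (∀ d₀ : ℝ, 0 < d₀ →
      (IsBarnesBeta a d₀ b (barnesBeta a d₀ b) ∧
        ∀ μ : Measure ℝ, IsBarnesBeta a d₀ b μ → μ = barnesBeta a d₀ b) ∧
      (∀ i : Fin (m + 1),
        IsBarnesBeta (i.removeNth a) d₀ b (barnesBeta (i.removeNth a) d₀ b) ∧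
        ∀ μ : Measure ℝ, IsBarnesBeta (i.removeNth a) d₀ b μ →
          μ = barnesBeta (i.removeNth a) d₀ b) ∧
      (IsBarnesBeta (![] : Fin 0 → ℝ) d₀ b (barnesBeta ![] d₀ b) ∧
        ∀ μ : Measure ℝ, IsBarnesBeta (![] : Fin 0 → ℝ) d₀ b μ → μ = barnesBeta ![] d₀ b)) ∧
    -- the Mellin transform of the ratio and its two factorizations
    (∀ q : ℂ, -b₀ < q.re → q.re < c₀ →
      Integrable (fun x : ℝ => (x : ℂ) ^ q) (barnesRatio a b₀ c₀ b) ∧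
      ∫ x : ℝ, (x : ℂ) ^ q ∂(barnesRatio a b₀ c₀ b)
        = barnesEta a b₀ b q * barnesEta a c₀ b (-q) ∧
      (∀ i : Fin (m + 1),
        HasProd (fun k : ℕ =>
          barnesEta (i.removeNth a) b₀ b (q + k * a i) / barnesEta (i.removeNth a) b₀ b (k * a i) *
          (barnesEta (i.removeNth a) c₀ b (-q + k * a i) /
            barnesEta (i.removeNth a) c₀ b (k * a i)))
          (∫ x : ℝ, (x : ℂ) ^ q ∂(barnesRatio a b₀ c₀ b))) ∧
      HasProd (fun n : Fin (m + 1) → ℕ =>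
        ∏ s : Finset (Fin m),
          (((b₀ + (∑ j ∈ s, (b j : ℂ)) + latticePoint a n) /
              (q + b₀ + (∑ j ∈ s, (b j : ℂ)) + latticePoint a n)) *
            ((c₀ + (∑ j ∈ s, (b j : ℂ)) + latticePoint a n) /
              (-q + c₀ + (∑ j ∈ s, (b j : ℂ)) + latticePoint a n))) ^ ((-1 : ℤ) ^ s.card))
        (∫ x : ℝ, (x : ℂ) ^ q ∂(barnesRatio a b₀ c₀ b))) ∧
    -- the factorization in law over `k = 0, 1, 2, …`
    (∀ (i : Fin (m + 1)) {Ω : Type*} [MeasurableSpace Ω] (P : Measure Ω) [IsProbabilityMeasure P]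
      (X Y : ℕ → Ω → ℝ),
      iIndepFun (Sum.elim X Y) P →
      (∀ k : ℕ, HasLaw (X k) (barnesBeta (i.removeNth a) (b₀ + k * a i) b) P) →
      (∀ k : ℕ, HasLaw (Y k) (barnesBeta (i.removeNth a) (c₀ + k * a i) b) P) →
      ∃ Z : Ω → ℝ, IsInfiniteProduct P (fun k ω => X k ω * (Y k ω)⁻¹) Z ∧
        HasLaw Z (barnesRatio a b₀ c₀ b) P) ∧
    -- the factorization in law over the lattice points
    (∀ {Ω : Type*} [MeasurableSpace Ω] (P : Measure Ω) [IsProbabilityMeasure P]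
      (X Y : (Fin (m + 1) → ℕ) → Ω → ℝ),
      iIndepFun (Sum.elim X Y) P →
      (∀ n, HasLaw (X n) (barnesBeta ![] (b₀ + latticePoint a n) b) P) →
      (∀ n, HasLaw (Y n) (barnesBeta ![] (c₀ + latticePoint a n) b) P) →
      ∃ Z : Ω → ℝ, IsInfiniteProduct P (fun n ω => X n ω * (Y n ω)⁻¹) Z ∧
        HasLaw Z (barnesRatio a b₀ c₀ b) P) ∧
    -- scaling invariance
    (∀ κ : ℝ, 0 < κ →
      (barnesRatio (fun i => κ * a i) (κ * b₀) (κ * c₀) (fun j => κ * b j)).map (fun x => x ^ κ)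
        = barnesRatio a b₀ c₀ b) := by
  have h1 : m + 1 ≤ m + 1 := le_rfl
  have h2 : m ≤ m + 1 := Nat.le_succ m
  have h3 : 0 ≤ m + 1 := Nat.zero_le _
  have ha' : ∀ (i : Fin (m + 1)) (j : Fin m), 0 < i.removeNth a j := fun i j => ha _
  have ha₀ : ∀ j, 0 < (![] : Fin 0 → ℝ) j := fun j => j.elim0
  have ho : ∀ (i : Fin (m + 1)) (k : ℕ), 0 ≤ (k : ℝ) * a i := fun i k =>
    mul_nonneg k.cast_nonneg (ha i).le
  have hΩ : ∀ n, 0 ≤ latticePoint a n := fun n =>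
    Finset.sum_nonneg fun i _ => mul_nonneg (n i).cast_nonneg (ha i).le
  have hi := fun (i : Fin (m + 1)) (t : ℝ) (ht : 0 < t) =>
    hasSum_exp_mul_barnesKernel_removeNth ha b i ht
  have hl := fun (t : ℝ) (ht : 0 < t) => hasSum_exp_mul_barnesKernel_latticePoint ha b ht
  refine ⟨fun d₀ hd₀ => ⟨?_, fun i => ?_, ?_⟩, fun q hq hq' => ⟨?_, ?_, fun i => ?_, ?_⟩,
    ?_, ?_, fun κ hκ => map_rpow_barnesRatio h1 ha hb hb₀ hc₀ hκ⟩
  · have h := isBarnesBeta_barnesBeta h1 ha hb hd₀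
    exact ⟨h, fun μ hμ => hμ.unique hd₀ h⟩
  · have h := isBarnesBeta_barnesBeta h2 (ha' i) hb hd₀
    exact ⟨h, fun μ hμ => hμ.unique hd₀ h⟩
  · have h := isBarnesBeta_barnesBeta h3 ha₀ hb hd₀
    exact ⟨h, fun μ hμ => hμ.unique hd₀ h⟩
  · exact (mellin_barnesRatio h1 ha hb hb₀ hc₀ hq hq').1
  · exact (mellin_barnesRatio h1 ha hb hb₀ hc₀ hq hq').2
  · refine (hasProd_barnesEta_mul h1 h2 ha (ha' i) hb hb₀ hc₀ (ho i) (hi i) hq hq').congr_fun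
      fun k => ?_
    have e : (k : ℂ) * a i = ((k * a i : ℝ) : ℂ) := by push_cast; rfl
    rw [e, barnesEta_add_div, barnesEta_add_div]
  · refine (hasProd_barnesEta_mul h1 h3 ha ha₀ hb hb₀ hc₀ hΩ hl hq hq').congr_fun fun n => ?_
    have := hΩ n
    rw [barnesEta_type_zero hb (by linarith) (by linarith),
      barnesEta_type_zero hb (by linarith) (by rw [Complex.neg_re]; linarith),
      ← Finset.prod_mul_distrib]
    refine Finset.prod_congr rfl fun s _ => ?_
    rw [← mul_zpow]
    push_cast
    ring_nf
  · intro i Ω _ P _ X Y hind hX hY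
    exact exists_isInfiniteProduct_barnesRatio h1 h2 ha (ha' i) hb hb₀ hc₀ (ho i) (hi i) P X Y
      hind hX hY
  · intro Ω _ P _ X Y hind hX hY
    exact exists_isInfiniteProduct_barnesRatio h1 h3 ha ha₀ hb hb₀ hc₀ hΩ hl P X Y hind hX hY
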